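/- **Corollary 3.2.** Let $p_1<p_2$ be real numbers, $p_0\in(p_1,p_2)$, $c\in\mathbb R$, $\mu\in(0,1)$, and $\psi(p):=-(p-p_0)^2+c$. Let $U(p)=(p-p_1)^{\mu-1}\tilde u(p)$ for $p\in(p_1,p_2)$, where $\tilde u\in\mathcal C^1([p_1,p_2],\mathbb C)$ and $\tilde u(p_1)\neq0$, and suppose that $U(p_2)=0$ (for the continuous extension of $U$ to $(p_1,p_2]$). For $\omega>0$ put $$\tilde H:=\sqrt\pi\,e^{-i\pi/4}e^{i\omega c}\,\tilde u(p_0),\qquad \tilde K_\mu:=\frac{\Gamma(\mu)}{2^\mu}\,e^{i\pi\mu/2}e^{i\omega\psi(p_1)}\,\tilde u(p_1).$$ Fix $\delta\in(\tfrac12,1)$ and put $\gamma:=2\delta-1$ and $L:=\frac{\sqrt\pi}{2}K^{\gamma}$, where $K$ is the unique positive solution of $\frac{\sqrt\pi}{2}K^2-\frac12K-\frac{\sqrt\pi}{4}=0$. Put $M:=\|\tilde u\|_{L^\infty(p_1,p_2)}$ and $W:=\|\tilde u\|_{W^{1,\infty}(p_1,p_2)}=\max(\|\tilde u\|_{L^\infty(p_1,p_2)},\|\tilde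 u'\|_{L^\infty(p_1,p_2)})$. Let $(R_k,\alpha_k,\beta_k)$, $k=1,\dots,8$, be 1. $\bigl(\frac{2^{2-\mu}}{\mu}(2-\mu)W,\;2-\mu,\;1\bigr)$, 2. $\bigl(\frac{2^{1-\mu}}{\mu}W,\;1-\mu,\;1\bigr)$, 3. $\bigl((1-\mu)\frac{2^{3-\mu}}{3}M,\;4-\mu,\;2\bigr)$, 4. $\bigl(\frac{L}{1-\gamma}2^{2-\mu}(1-\mu)W,\;1+\gamma-\mu,\;\delta\bigr)$, 5. $\bigl(\frac{L}{1-\gamma}2^{1-\mu}W,\;\gamma-\mu,\;\delta\bigr)$, 6. $\bigl(\frac{\sqrt\pi}{2^{\mu-2}}M,\;3-\mu,\;\frac32\bigr)$, 7. $\bigl(\frac{L}{1-\gamma}(1-\mu)(p_2-p_1)^{1-\gamma}W,\;2-\mu,\;\delta\bigr)$, 8. $\bigl(\frac{L}{1-\gamma}(p_2-p_1)^{1-\gamma}W,\;1-\mu,\;\delta\bigr)$. Then the integral $\int_{p_1}^{p_2}U(p)e^{i\omega\psi(p)}\,dp$ converges absolutely, all the constants below are nonnegative, and for all $\omega>0$: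 * If $\mu>\frac12$, then, with the additional triple $(R_0,\alpha_0,\beta_0):=\bigl(\frac{\Gamma(\mu)}{2^\mu}M,\mu,\mu\bigr)$, $$\Bigl|\int_{p_1}^{p_2}U e^{i\omega\psi}\,dp-\tilde H\,(p_0-p_1)^{\mu-1}\omega^{-1/2}\Bigr|\le\sum_{k=0}^{8}R_k(p_0-p_1)^{-\alpha_k}\omega^{-\beta_k},\qquad \beta_k>\tfrac12\ \text{ for } k=0,\dots,8.$$ * If $\mu=\frac12$, then $$\Bigl|\int_{p_1}^{p_2}U e^{i\omega\psi}\,dp-(\tilde H+\tilde K_\mu)(p_0-p_1)^{-1/2}\omega^{-1/2}\Bigr|\le\sum_{k=1}^{8}R_k(p_0-p_1)^{-\alpha_k}\omega^{-\beta_k},\qquad \beta_k>\tfrac12\ \text{ for } k=1,\dots,8.$$ * If $\mu<\frac12$, then, with the additional triple $(R_0,\alpha_0,\beta_0):=\bigl(\sqrt\pi\,M,1-\mu,\tfrac12\bigr)$, $$\Bigl|\int_{p_1}^{p_2}U e^{i\omega\psi}\,dp-\tilde K_\mu\,(p_0-p_1)^{-\mu}\omega^{-\mu}\Bigr|\le\sum_{k=0}^{8}R_k(p_0-p_1)^{-\alpha_k}\omega^{-\beta_k},\qquad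 \beta_k>\mu\ \text{ for } k=0,\dots,8.$$ -/

import Mathlib

open MeasureTheory
open scoped Topology

noncomputable section

namespace StatPhase

/-- `U` satisfies Assumption (A_{μ₁,μ₂,N}) on `[p₁, p₂]` with regular part `u`:
`U p = (p - p₁)^(μ₁ - 1) (p₂ - p)^(μ₂ - 1) u p` on the open interval `(p₁, p₂)`, where `u` is of
class `C^N` on the closed interval and does not vanish at a genuine singularity.
Only the values of `U` on `(p₁, p₂)` and of `u` on `[p₁, p₂]` matter. -/
structure IsAmplitude (p₁ p₂ μ₁ μ₂ : ℝ) (N : ℕ) (U u : ℝ → ℂ) : Prop where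
  contDiffOn : ContDiffOn ℝ N u (Set.Icc p₁ p₂)
  factor : ∀ p ∈ Set.Ioo p₁ p₂,
    U p = (((p - p₁) ^ (μ₁ - 1) * (p₂ - p) ^ (μ₂ - 1) : ℝ) : ℂ) * u p
  ne_zero_left : μ₁ ≠ 1 → u p₁ ≠ 0
  ne_zero_right : μ₂ ≠ 1 → u p₂ ≠ 0

/-- The phase `ψ(p) = -(p - p₀)² + c`. -/
def phase (p₀ c p : ℝ) : ℝ := -(p - p₀) ^ 2 + c

/-- The integrand `U(p) e^{iωψ(p)}`. -/
def integrand (U : ℝ → ℂ) (ψ : ℝ → ℝ) (ω p : ℝ) : ℂ :=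
  U p * Complex.exp (Complex.I * ω * ψ p)

/-- `H̃ = √π e^{-iπ/4} e^{iωc} ũ(p₀)`. -/
def coeffH (p₀ c : ℝ) (u : ℝ → ℂ) (ω : ℝ) : ℂ :=
  (Real.sqrt Real.pi : ℂ) * Complex.exp (-(Complex.I * (Real.pi / 4))) *
    Complex.exp (Complex.I * ω * c) * u p₀

/-- `K̃_μ = (Γ(μ) / 2^μ) e^{iπμ/2} e^{iωψ(p₁)} ũ(p₁)`. -/
def coeffK (μ p₁ : ℝ) (ψ : ℝ → ℝ) (u : ℝ → ℂ) (ω : ℝ) : ℂ :=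
  ((Real.Gamma μ / (2 : ℝ) ^ μ : ℝ) : ℂ) * Complex.exp (Complex.I * (Real.pi * μ / 2)) *
    Complex.exp (Complex.I * ω * ψ p₁) * u p₁

/-- The norm of `L^∞(p₁, p₂)`. -/
def normLinf (p₁ p₂ : ℝ) (u : ℝ → ℂ) : ℝ :=
  (eLpNorm u ⊤ (volume.restrict (Set.Ioo p₁ p₂))).toReal

/-- The norm of `W^{1,∞}(p₁, p₂)`, for functions that are `C¹` on `[p₁, p₂]`
(their weak derivative is the classical one). -/
def normW1inf (p₁ p₂ : ℝ) (u : ℝ → ℂ) : ℝ :=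
  max (normLinf p₁ p₂ u) (normLinf p₁ p₂ (deriv u))

/-- The positive root of `a K² - b K - c = 0`, where `a = √π / 2`, `b = 1 / 2`, `c = √π / 4`;
see `rootK_spec`. -/
def rootK : ℝ := (1 / 2 + Real.sqrt (1 / 4 + Real.pi / 2)) / Real.sqrt Real.pi

theorem rootK_spec (K : ℝ) :
    (0 < K ∧ Real.sqrt Real.pi / 2 * K ^ 2 - 1 / 2 * K - Real.sqrt Real.pi / 4 = 0) ↔
      K = rootK := by
  have hs : 0 < Real.sqrt Real.pi := Real.sqrt_pos.2 Real.pi_pos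
  have hs2 : Real.sqrt Real.pi ^ 2 = Real.pi := Real.sq_sqrt Real.pi_pos.le
  have ht0 : 0 ≤ 1 / 4 + Real.pi / 2 := by positivity
  have ht : 0 < Real.sqrt (1 / 4 + Real.pi / 2) := Real.sqrt_pos.2 (by positivity)
  have ht2 : Real.sqrt (1 / 4 + Real.pi / 2) ^ 2 = 1 / 4 + Real.pi / 2 := Real.sq_sqrt ht0
  have ht3 : 1 / 2 < Real.sqrt (1 / 4 + Real.pi / 2) := by
    nlinarith [Real.pi_pos]
  unfold rootK
  rw [eq_div_iff hs.ne']
  generalize Real.sqrt Real.pi = s at *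
  generalize Real.sqrt (1 / 4 + Real.pi / 2) = t at *
  constructor
  · rintro ⟨hK, h⟩
    have h1 : (K * s - 1 / 2 - t) * (K * s - 1 / 2 + t) = 0 := by
      linear_combination 2 * s * h - ht2 + hs2 / 2
    rcases mul_eq_zero.1 h1 with h2 | h2
    · linarith
    · have : 0 < K * s := mul_pos hK hs
      linarith
  · intro h
    have hK : 0 < K := by
      by_contra hK
      nlinarith
    refine ⟨hK, ?_⟩
    have h1 : s * (s / 2 * K ^ 2 - 1 / 2 * K - s / 4) = 0 := by
      linear_combination (1 / 2) * (K * s - 1 / 2 + t) * h + ht2 / 2 - hs2 / 4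
    rcases mul_eq_zero.1 h1 with h2 | h2
    · linarith
    · exact h2

/-- The constant `L_{γ,2} = a K^γ`. -/
def constL (γ : ℝ) : ℝ := Real.sqrt Real.pi / 2 * rootK ^ γ

/-- The constants `R_1, …, R_6` of the remainder of `∫_{p₁}^{p₀}`, with `γ = 2δ - 1`. -/
def R₁ (p₁ p₂ μ δ : ℝ) (u : ℝ → ℂ) : Fin 6 → ℝ :=
  ![(2 : ℝ) ^ (2 - μ) / μ * (2 - μ) * normW1inf p₁ p₂ u,
    (2 : ℝ) ^ (1 - μ) / μ * normW1inf p₁ p₂ u,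
    (1 - μ) * ((2 : ℝ) ^ (3 - μ) / 3) * normLinf p₁ p₂ u,
    constL (2 * δ - 1) / (1 - (2 * δ - 1)) * (2 : ℝ) ^ (2 - μ) * (1 - μ) * normW1inf p₁ p₂ u,
    constL (2 * δ - 1) / (1 - (2 * δ - 1)) * (2 : ℝ) ^ (1 - μ) * normW1inf p₁ p₂ u,
    Real.sqrt Real.pi / (2 : ℝ) ^ (μ - 2) * normLinf p₁ p₂ u]

/-- The exponents of `(p₀ - p₁)⁻¹` that go with `R₁`. -/
def α₁ (μ δ : ℝ) : Fin 6 → ℝ :=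
  ![2 - μ, 1 - μ, 4 - μ, -μ + 1 + (2 * δ - 1), (2 * δ - 1) - μ, 3 - μ]

/-- The exponents of `ω⁻¹` that go with `R₁`. -/
def β₁ (δ : ℝ) : Fin 6 → ℝ := ![1, 1, 2, δ, δ, 3 / 2]

/-- The constants `R_1, R_2` of the remainder of `∫_{p₀}^{p₂}`, with `γ = 2δ - 1`. -/
def R₂ (p₁ p₂ μ δ : ℝ) (u : ℝ → ℂ) : Fin 2 → ℝ :=
  ![constL (2 * δ - 1) / (1 - (2 * δ - 1)) * (1 - μ) * (p₂ - p₁) ^ (1 - (2 * δ - 1)) *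
      normW1inf p₁ p₂ u,
    constL (2 * δ - 1) / (1 - (2 * δ - 1)) * (p₂ - p₁) ^ (1 - (2 * δ - 1)) * normW1inf p₁ p₂ u]

/-- The exponents of `(p₀ - p₁)⁻¹` that go with `R₂`. -/
def α₂ (μ : ℝ) : Fin 2 → ℝ := ![2 - μ, 1 - μ]

/-- The exponents of `ω⁻¹` that go with `R₂`. -/
def β₂ (δ : ℝ) : Fin 2 → ℝ := ![δ, δ]

/-! Constants and exponents for the full integral: `μ > 1/2`, `μ = 1/2`, `μ < 1/2`. -/

def RGt (p₁ p₂ μ δ : ℝ) (u : ℝ → ℂ) : Fin 9 → ℝ :=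
  Fin.cons (Real.Gamma μ / (2 : ℝ) ^ μ * normLinf p₁ p₂ u)
    (Fin.append (R₁ p₁ p₂ μ δ u) (R₂ p₁ p₂ μ δ u))

def αGt (μ δ : ℝ) : Fin 9 → ℝ := Fin.cons μ (Fin.append (α₁ μ δ) (α₂ μ))

def βGt (μ δ : ℝ) : Fin 9 → ℝ := Fin.cons μ (Fin.append (β₁ δ) (β₂ δ))

def REq (p₁ p₂ μ δ : ℝ) (u : ℝ → ℂ) : Fin 8 → ℝ :=
  Fin.append (R₁ p₁ p₂ μ δ u) (R₂ p₁ p₂ μ δ u)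

def αEq (μ δ : ℝ) : Fin 8 → ℝ := Fin.append (α₁ μ δ) (α₂ μ)

def βEq (δ : ℝ) : Fin 8 → ℝ := Fin.append (β₁ δ) (β₂ δ)

def RLt (p₁ p₂ μ δ : ℝ) (u : ℝ → ℂ) : Fin 9 → ℝ :=
  Fin.cons (Real.sqrt Real.pi * normLinf p₁ p₂ u)
    (Fin.append (R₁ p₁ p₂ μ δ u) (R₂ p₁ p₂ μ δ u))

def αLt (μ δ : ℝ) : Fin 9 → ℝ := Fin.cons (1 - μ) (Fin.append (α₁ μ δ) (α₂ μ))

def βLt (δ : ℝ) : Fin 9 → ℝ := Fin.cons (1 / 2) (Fin.append (β₁ δ) (β₂ δ))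

end StatPhase

end

/-! Put x = p - p₁, A = p₀ - p₁, P = p₂ - p₁. Up to a unimodular factor the integral is that of
x^(μ-1) w(x) e^{-iω(x-A)²} over [0, P]. It is cut at A/2 and A, so that each piece sees at most one
critical point, and each piece is integrated by parts once against an exact antiderivative of its
oscillating kernel.

On [0, A/2] the variable v = x(2A - x) = A² - (x - A)² makes the phase linear, and the kernel
v^(μ-1) e^{iωv} has antiderivative `oscTail`, a Laplace integral along a vertical ray. On [A/2, A]
and [A, P] the variable s = |x - A| gives the kernel e^{-iωs²}, with antiderivative `fresnelTail`,
which is half the conjugate of `oscTail` for μ = 1/2 at v = s².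

The boundary terms are the whole expansion: x = 0 yields the `coeffK` term, x = A yields half of the
`coeffH` term from each side, x = P yields nothing since w(P) = 0, and the two terms at A/2 cancel
to leading order (`norm_midpoint_boundary_le`), leaving errors 3 and 6. The remaining integrals give
errors 1, 2 (left), 4, 5 (middle) and 7, 8 (right). Near A the bound on `fresnelTail` must be
integrable in s and smaller than ω^(-1/2); interpolation (`norm_fresnelTail_le_interp`) gives s^(-γ)
ω^(-δ).

The result is one estimate valid for every μ in (0, 1), `IsAmplitude.norm_integral_sub_le`. The
three regimes only decide which of the two main terms is moved into the error. -/

noncomputable section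

namespace StatPhase

/-! ### Laplace integrals along vertical rays -/

/-- The power `(v + ir)^a` along a vertical ray. -/
def rayPow (a v r : ℝ) : ℂ := ((v : ℂ) + r * Complex.I) ^ (a : ℂ)

/-- The Laplace transform `∫₀^∞ (v + ir)^a e^{-ωr} dr` along a vertical ray. -/
def rayInt (a ω v : ℝ) : ℂ :=
  ∫ r in Set.Ioi (0 : ℝ), rayPow a v r * (Real.exp (-ω * r) : ℂ)

/-- For a nonpositive exponent, the first bound produces decay in v, the second a bound uniform up
to the singular point v = 0. -/
theorem le_norm_ray (v r : ℝ) : v ≤ ‖(v : ℂ) + r * Complex.I‖ ∧ r ≤ ‖(v : ℂ) + r * Complex.I‖ := by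
  have h1 := Complex.re_le_norm ((v : ℂ) + r * Complex.I)
  have h2 := Complex.im_le_norm ((v : ℂ) + r * Complex.I)
  simp at h1 h2
  exact ⟨h1, h2⟩

theorem ray_mem_slitPlane {v r : ℝ} (h : 0 < v ∨ r ≠ 0) :
    (v : ℂ) + r * Complex.I ∈ Complex.slitPlane := by
  rw [Complex.mem_slitPlane_iff]
  simpa using h

theorem norm_rayPow_le_left {a v : ℝ} (ha : a ≤ 0) (hv : 0 < v) (r : ℝ) :
    ‖rayPow a v r‖ ≤ v ^ a := by
  rw [rayPow, Complex.norm_cpow_real]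
  exact Real.rpow_le_rpow_of_nonpos hv (le_norm_ray v r).1 ha

theorem norm_rayPow_le_right {a r : ℝ} (ha : a ≤ 0) (v : ℝ) (hr : 0 < r) :
    ‖rayPow a v r‖ ≤ r ^ a := by
  rw [rayPow, Complex.norm_cpow_real]
  exact Real.rpow_le_rpow_of_nonpos hr (le_norm_ray v r).2 ha

theorem hasDerivAt_rayPow_left (a : ℝ) {v r : ℝ} (h : 0 < v ∨ r ≠ 0) :
    HasDerivAt (fun v => rayPow a v r) (a * rayPow (a - 1) v r) v := by
  have h1 : HasDerivAt (fun z : ℂ => (z + r * Complex.I) ^ (a : ℂ))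
      (a * ((v : ℂ) + r * Complex.I) ^ ((a : ℂ) - 1) * 1) (v : ℂ) :=
    HasDerivAt.cpow_const ((hasDerivAt_id _).add_const _) (ray_mem_slitPlane h)
  have h2 := h1.comp_ofReal
  simpa [rayPow] using h2

theorem hasDerivAt_rayPow_right (a : ℝ) {v r : ℝ} (h : 0 < v ∨ r ≠ 0) :
    HasDerivAt (fun r => rayPow a v r) (a * rayPow (a - 1) v r * Complex.I) r := by
  have h1 : HasDerivAt (fun z : ℂ => ((v : ℂ) + z * Complex.I) ^ (a : ℂ))
      (a * ((v : ℂ) + r * Complex.I) ^ ((a : ℂ) - 1) * Complex.I) (r : ℂ) :=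
    HasDerivAt.cpow_const (by simpa using ((hasDerivAt_id (r : ℂ)).mul_const Complex.I).const_add (v : ℂ))
      (ray_mem_slitPlane h)
  have h2 := h1.comp_ofReal
  simpa [rayPow] using h2

theorem aestronglyMeasurable_rayPow (a ω : ℝ) (v : ℝ) :
    AEStronglyMeasurable (fun r => rayPow a v r * (Real.exp (-ω * r) : ℂ))
      (volume.restrict (Set.Ioi 0)) := by
  refine ContinuousOn.aestronglyMeasurable (fun r hr => ?_) measurableSet_Ioi
  refine ContinuousAt.continuousWithinAt (ContinuousAt.mul
    (hasDerivAt_rayPow_right a (Or.inr (ne_of_gt hr))).continuousAt ?_)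
  fun_prop

theorem norm_rayPow_mul_exp (a ω v r : ℝ) :
    ‖rayPow a v r * (Real.exp (-ω * r) : ℂ)‖ = ‖rayPow a v r‖ * Real.exp (-ω * r) := by
  rw [norm_mul, Complex.norm_real, Real.norm_of_nonneg (Real.exp_pos _).le]

theorem integrable_rayPow_left {a ω v : ℝ} (ha : a ≤ 0) (hω : 0 < ω) (hv : 0 < v) :
    IntegrableOn (fun r => rayPow a v r * (Real.exp (-ω * r) : ℂ)) (Set.Ioi 0) := by
  refine Integrable.mono' ((exp_neg_integrableOn_Ioi 0 hω).const_mul (v ^ a))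
    (aestronglyMeasurable_rayPow a ω v) (Filter.Eventually.of_forall fun r => ?_)
  rw [norm_rayPow_mul_exp]
  gcongr
  exact norm_rayPow_le_left ha hv r

theorem norm_rayInt_le_left {a ω v : ℝ} (ha : a ≤ 0) (hω : 0 < ω) (hv : 0 < v) :
    ‖rayInt a ω v‖ ≤ v ^ a / ω := by
  have h1 : ∫ r in Set.Ioi (0 : ℝ), v ^ a * Real.exp (-ω * r) = v ^ a / ω := by
    rw [integral_const_mul, integral_exp_mul_Ioi (by linarith)]
    simp [div_eq_mul_inv]
  rw [← h1]
  refine norm_integral_le_of_norm_le ((exp_neg_integrableOn_Ioi 0 hω).const_mul (v ^ a))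
    (Filter.Eventually.of_forall fun r => ?_)
  rw [norm_rayPow_mul_exp]
  gcongr
  exact norm_rayPow_le_left ha hv r

theorem integrableOn_rpow_mul_exp {a ω : ℝ} (ha : -1 < a) (hω : 0 < ω) :
    IntegrableOn (fun r : ℝ => r ^ a * Real.exp (-ω * r)) (Set.Ioi 0) := by
  simpa using integrableOn_rpow_mul_exp_neg_mul_rpow ha one_pos hω

theorem integral_rpow_mul_exp {a ω : ℝ} (ha : -1 < a) (hω : 0 < ω) :
    ∫ r in Set.Ioi (0 : ℝ), r ^ a * Real.exp (-ω * r) = Real.Gamma (a + 1) * ω ^ (-(a + 1)) := by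
  have h := Real.integral_rpow_mul_exp_neg_mul_Ioi (a := a + 1) (by linarith) hω
  simp only [add_sub_cancel_right, ← neg_mul] at h
  rw [h, one_div, Real.inv_rpow hω.le, Real.rpow_neg hω.le, mul_comm]

theorem norm_rayInt_le_right {a ω : ℝ} (ha : a ≤ 0) (ha' : -1 < a) (hω : 0 < ω) (v : ℝ) :
    ‖rayInt a ω v‖ ≤ Real.Gamma (a + 1) * ω ^ (-(a + 1)) := by
  rw [← integral_rpow_mul_exp ha' hω]
  refine norm_integral_le_of_norm_le (integrableOn_rpow_mul_exp ha' hω)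
    ((ae_restrict_iff' measurableSet_Ioi).2 (Filter.Eventually.of_forall fun r hr => ?_))
  rw [norm_rayPow_mul_exp]
  gcongr
  exact norm_rayPow_le_right ha v hr

/-- On the imaginary axis (ir)^a = e^{iπa/2} r^a, and a Gamma integral remains. -/
theorem rayInt_zero {a ω : ℝ} (ha' : -1 < a) (hω : 0 < ω) :
    rayInt a ω 0 = Complex.exp (Complex.I * (Real.pi * a / 2)) *
      ((Real.Gamma (a + 1) * ω ^ (-(a + 1)) : ℝ) : ℂ) := by
  rw [← integral_rpow_mul_exp ha' hω, ← integral_complex_ofReal, ← integral_const_mul, rayInt]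
  refine setIntegral_congr_fun measurableSet_Ioi fun r (hr : 0 < r) => ?_
  have hne : (r : ℂ) ≠ 0 := by exact_mod_cast hr.ne'
  simp only [rayPow, Complex.ofReal_zero, zero_add, Complex.ofReal_mul]
  rw [Complex.ofReal_cpow hr.le, Complex.cpow_def_of_ne_zero (by simp [hne]),
    Complex.cpow_def_of_ne_zero hne, Complex.log_ofReal_mul hr Complex.I_ne_zero, Complex.log_I,
    ← mul_assoc, ← Complex.exp_add, Complex.ofReal_log hr.le]
  congr 2
  ring

theorem hasDerivAt_rayInt {a ω v : ℝ} (ha : a ≤ 0) (hω : 0 < ω) (hv : 0 < v) :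
    HasDerivAt (rayInt a ω) (a * rayInt (a - 1) ω v) v := by
  have h := hasDerivAt_integral_of_dominated_loc_of_deriv_le
    (μ := volume.restrict (Set.Ioi (0 : ℝ)))
    (F := fun v r => rayPow a v r * (Real.exp (-ω * r) : ℂ))
    (F' := fun v r => a * (rayPow (a - 1) v r * (Real.exp (-ω * r) : ℂ)))
    -- The exponent a - 1 may be too singular for the bound by powers of r, so the domination stays
    -- at distance v/2 from the origin.
    (bound := fun r => |a| * ((v / 2) ^ (a - 1) * Real.exp (-ω * r)))
    (x₀ := v) (s := Set.Ioi (v / 2)) (Ioi_mem_nhds (by linarith))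
    (Filter.Eventually.of_forall fun w => aestronglyMeasurable_rayPow a ω w)
    (integrable_rayPow_left ha hω hv)
    ((aestronglyMeasurable_rayPow (a - 1) ω v).const_mul _)
    (Filter.Eventually.of_forall fun r w (hw : v / 2 < w) => ?_)
    (((exp_neg_integrableOn_Ioi 0 hω).const_mul _).const_mul _)
    (Filter.Eventually.of_forall fun r w (hw : v / 2 < w) => ?_)
  · have h2 := h.2
    rw [integral_const_mul] at h2
    exact h2
  · rw [norm_mul, norm_rayPow_mul_exp, Complex.norm_real, Real.norm_eq_abs]
    gcongr
    exact (norm_rayPow_le_left (by linarith) (by linarith) r).trans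
      (Real.rpow_le_rpow_of_nonpos (by linarith) hw.le (by linarith))
  · have := (hasDerivAt_rayPow_left a (v := w) (r := r) (Or.inl (by linarith))).mul_const
      (Real.exp (-ω * r) : ℂ)
    rwa [mul_assoc] at this

theorem continuousOn_rayInt {a ω : ℝ} (ha : a ≤ 0) (ha' : -1 < a) (hω : 0 < ω) :
    ContinuousOn (rayInt a ω) (Set.Ici 0) := by
  intro v hv
  refine continuousWithinAt_of_dominated (bound := fun r => r ^ a * Real.exp (-ω * r))
    (Filter.Eventually.of_forall fun w => aestronglyMeasurable_rayPow a ω w)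
    (Filter.Eventually.of_forall fun w => ?_) (integrableOn_rpow_mul_exp ha' hω) ?_
  · refine (ae_restrict_iff' measurableSet_Ioi).2 (Filter.Eventually.of_forall fun r hr => ?_)
    rw [norm_rayPow_mul_exp]
    gcongr
    exact norm_rayPow_le_right ha w hr
  · refine (ae_restrict_iff' measurableSet_Ioi).2 (Filter.Eventually.of_forall fun r hr => ?_)
    exact ((hasDerivAt_rayPow_left a (Or.inr (ne_of_gt hr))).continuousAt.mul
      continuousAt_const).continuousWithinAt

/-- Integration by parts along the ray. -/
theorem rayInt_recurrence {a ω v : ℝ} (ha : a ≤ 0) (hω : 0 < ω) (hv : 0 < v) :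
    ω * rayInt a ω v - Complex.I * a * rayInt (a - 1) ω v = ((v ^ a : ℝ) : ℂ) := by
  have hexp (r : ℝ) : HasDerivAt (fun r : ℝ => (Real.exp (-ω * r) : ℂ))
      ((-ω * Real.exp (-ω * r) : ℝ) : ℂ) r := by
    refine HasDerivAt.ofReal_comp ?_
    have := ((hasDerivAt_id r).const_mul (-ω)).exp
    simpa [mul_comm] using this
  have hd (r : ℝ) := (hasDerivAt_rayPow_right a (v := v) (r := r) (Or.inl hv)).mul (hexp r)
  have i1 := (integrable_rayPow_left (a := a - 1) (by linarith) hω hv).const_mul (a * Complex.I)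
  have i2 := (integrable_rayPow_left ha hω hv).const_mul (-ω : ℂ)
  have hfun : (fun r : ℝ => a * Complex.I * (rayPow (a - 1) v r * (Real.exp (-ω * r) : ℂ)) +
      -ω * (rayPow a v r * (Real.exp (-ω * r) : ℂ))) = fun r : ℝ =>
      a * rayPow (a - 1) v r * Complex.I * (Real.exp (-ω * r) : ℂ) +
        rayPow a v r * ((-ω * Real.exp (-ω * r) : ℝ) : ℂ) := by
    ext r
    push_cast
    ring
  have hlim : Filter.Tendsto (fun r : ℝ => rayPow a v r * (Real.exp (-ω * r) : ℂ))
      Filter.atTop (𝓝 0) := by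
    refine squeeze_zero_norm (a := fun r : ℝ => v ^ a * Real.exp (-ω * r)) (fun r => ?_) ?_
    · rw [norm_rayPow_mul_exp]
      gcongr
      exact norm_rayPow_le_left ha hv r
    · have : Filter.Tendsto (fun r : ℝ => Real.exp (-ω * r)) Filter.atTop (𝓝 0) := by
        refine Real.tendsto_exp_atBot.comp ?_
        exact Filter.tendsto_id.const_mul_atTop_of_neg (by linarith)
      simpa using this.const_mul (v ^ a)
  have h := integral_Ioi_of_hasDerivAt_of_tendsto (a := 0) (hd 0).continuousAt.continuousWithinAt
    (fun r _ => hd r) (by rw [← hfun]; exact i1.add i2) hlim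
  rw [← hfun, integral_add i1 i2, integral_const_mul, integral_const_mul] at h
  have h0 : rayPow a v 0 = ((v ^ a : ℝ) : ℂ) := by
    simp [rayPow, Complex.ofReal_cpow hv.le]
  simp only [Pi.mul_apply, h0, mul_zero, Real.exp_zero, Complex.ofReal_one, mul_one] at h
  simp only [rayInt]
  linear_combination -h

/-! ### The antiderivative of the singular kernel -/

/-- The antiderivative `-∫_v^∞ t^(μ - 1) e^{iωt} dt` of `t^(μ - 1) e^{iωt}`, with the path of
integration rotated to a vertical ray. -/
def oscTail (μ ω v : ℝ) : ℂ :=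
  -(Complex.I * Complex.exp (Complex.I * ω * v)) * rayInt (μ - 1) ω v

theorem norm_exp_I_mul (ω v : ℝ) : ‖Complex.exp (Complex.I * ω * v)‖ = 1 := by
  have := Complex.norm_exp_ofReal_mul_I (ω * v)
  rwa [show ((ω * v : ℝ) : ℂ) * Complex.I = Complex.I * ω * v by push_cast; ring] at this

theorem hasDerivAt_exp_I_mul (ω v : ℝ) :
    HasDerivAt (fun v : ℝ => Complex.exp (Complex.I * ω * v))
      (Complex.I * ω * Complex.exp (Complex.I * ω * v)) v := by
  have h : HasDerivAt (fun z : ℂ => Complex.exp (Complex.I * ω * z))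
      (Complex.exp (Complex.I * ω * v) * (Complex.I * ω * 1)) (v : ℂ) :=
    ((hasDerivAt_id (v : ℂ)).const_mul (Complex.I * ω)).cexp
  convert h.comp_ofReal using 1
  ring

theorem norm_oscTail (μ ω v : ℝ) : ‖oscTail μ ω v‖ = ‖rayInt (μ - 1) ω v‖ := by
  rw [oscTail, norm_mul, norm_neg, norm_mul, norm_exp_I_mul, Complex.norm_I, one_mul, one_mul]

/-- No contour is deformed: the product rule gives exactly the combination of ray integrals that
`rayInt_recurrence` evaluates to v^(μ-1). -/
theorem hasDerivAt_oscTail {μ ω v : ℝ} (hμ : μ ≤ 1) (hω : 0 < ω) (hv : 0 < v) :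
    HasDerivAt (oscTail μ ω) (((v ^ (μ - 1) : ℝ) : ℂ) * Complex.exp (Complex.I * ω * v)) v := by
  have h := (((hasDerivAt_exp_I_mul ω v).const_mul Complex.I).neg).mul
    (hasDerivAt_rayInt (a := μ - 1) (by linarith) hω hv)
  refine HasDerivAt.congr_deriv (f := oscTail μ ω) h ?_
  rw [← rayInt_recurrence (by linarith) hω hv, Pi.neg_apply]
  linear_combination -(ω * Complex.exp (Complex.I * ω * v) * rayInt (μ - 1) ω v) * Complex.I_sq

theorem continuousOn_oscTail {μ ω : ℝ} (hμ : μ ≤ 1) (hμ' : 0 < μ) (hω : 0 < ω) :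
    ContinuousOn (oscTail μ ω) (Set.Ici 0) := by
  refine ContinuousOn.mul (Continuous.continuousOn ?_)
    (continuousOn_rayInt (by linarith) (by linarith) hω)
  fun_prop

theorem norm_oscTail_le {μ ω v : ℝ} (hμ : μ ≤ 1) (hω : 0 < ω) (hv : 0 < v) :
    ‖oscTail μ ω v‖ ≤ v ^ (μ - 1) / ω :=
  (norm_oscTail μ ω v).trans_le (norm_rayInt_le_left (by linarith) hω hv)

theorem norm_oscTail_le_Gamma {μ ω : ℝ} (hμ : μ ≤ 1) (hμ' : 0 < μ) (hω : 0 < ω) (v : ℝ) :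
    ‖oscTail μ ω v‖ ≤ Real.Gamma μ * ω ^ (-μ) := by
  have := norm_rayInt_le_right (a := μ - 1) (by linarith) (by linarith) hω v
  rwa [sub_add_cancel, ← norm_oscTail] at this

theorem oscTail_zero {μ ω : ℝ} (hμ' : 0 < μ) (hω : 0 < ω) :
    oscTail μ ω 0 = -(((Real.Gamma μ * ω ^ (-μ) : ℝ) : ℂ) *
      Complex.exp (Complex.I * (Real.pi * μ / 2))) := by
  have h : Complex.I * Complex.exp (Complex.I * (Real.pi * (μ - 1 : ℝ) / 2)) =
      Complex.exp (Complex.I * (Real.pi * μ / 2)) := by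
    -- The prefactor i = e^{iπ/2} turns the exponent μ - 1 into μ.
    nth_rewrite 1 [← Complex.exp_pi_div_two_mul_I]
    rw [← Complex.exp_add]
    congr 1
    push_cast
    ring
  rw [oscTail, rayInt_zero (by linarith) hω, ← h]
  simp only [Complex.ofReal_zero, mul_zero, Complex.exp_zero, sub_add_cancel]
  ring

/-- One more integration by parts along the ray isolates the leading term; the remainder is (μ -
1)/ω times the ray integral of exponent μ - 2. -/
theorem norm_oscTail_sub_le {μ ω v : ℝ} (hμ : μ ≤ 1) (hω : 0 < ω) (hv : 0 < v) :
    ‖oscTail μ ω v -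
      ((v ^ (μ - 1) : ℝ) : ℂ) * Complex.exp (Complex.I * ω * v) / (Complex.I * ω)‖ ≤
      (1 - μ) * v ^ (μ - 2) / ω ^ 2 := by
  have hω' : (ω : ℂ) ≠ 0 := by exact_mod_cast hω.ne'
  have h : oscTail μ ω v -
      ((v ^ (μ - 1) : ℝ) : ℂ) * Complex.exp (Complex.I * ω * v) / (Complex.I * ω) =
      Complex.exp (Complex.I * ω * v) * (((μ - 1) / ω : ℝ) : ℂ) * rayInt (μ - 2) ω v := by
    rw [← rayInt_recurrence (a := μ - 1) (by linarith) hω hv, oscTail,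
      show μ - 1 - 1 = μ - 2 by ring]
    field_simp [Complex.I_ne_zero]
    push_cast
    field_simp
    linear_combination -(ω * rayInt (μ - 1) ω v) * Complex.I_sq
  rw [h, norm_mul, norm_mul, norm_exp_I_mul, one_mul, Complex.norm_real, Real.norm_eq_abs,
    abs_div, abs_of_pos hω, abs_of_nonpos (by linarith)]
  calc -(μ - 1) / ω * ‖rayInt (μ - 2) ω v‖ ≤ -(μ - 1) / ω * (v ^ (μ - 2) / ω) := by
        gcongr
        · exact div_nonneg (by linarith) hω.le
        · exact norm_rayInt_le_left (by linarith) hω hv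
    _ = _ := by field_simp; ring

/-- A cruder bound, of lower order in 1/ω, to be combined with the previous one by a geometric mean.
-/
theorem norm_oscTail_sub_le' {μ ω v : ℝ} (hμ : μ ≤ 1) (hω : 0 < ω) (hv : 0 < v) :
    ‖oscTail μ ω v -
      ((v ^ (μ - 1) : ℝ) : ℂ) * Complex.exp (Complex.I * ω * v) / (Complex.I * ω)‖ ≤
      2 * v ^ (μ - 1) / ω := by
  refine (norm_sub_le _ _).trans ?_
  have h : ‖((v ^ (μ - 1) : ℝ) : ℂ) * Complex.exp (Complex.I * ω * v) / (Complex.I * ω)‖ =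
      v ^ (μ - 1) / ω := by
    rw [norm_div, norm_mul, norm_exp_I_mul, norm_mul, Complex.norm_I, Complex.norm_real,
      Complex.norm_real, Real.norm_of_nonneg (by positivity), Real.norm_of_nonneg hω.le]
    simp
  rw [h]
  have := norm_oscTail_le hμ hω hv
  calc _ ≤ v ^ (μ - 1) / ω + v ^ (μ - 1) / ω := by gcongr
    _ = _ := by ring

/-! ### The Fresnel tail -/

/-- The antiderivative `-∫_s^∞ e^{-iωt²} dt` of `e^{-iωs²}` on the positive half-line. -/
def fresnelTail (ω s : ℝ) : ℂ := (1 / 2) * (starRingEnd ℂ) (oscTail (1 / 2) ω (s ^ 2))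

theorem sq_rpow_neg_half {s : ℝ} (hs : 0 < s) : (s ^ 2) ^ ((1 : ℝ) / 2 - 1) = s⁻¹ := by
  rw [← Real.rpow_natCast, ← Real.rpow_mul hs.le, ← Real.rpow_neg_one]
  norm_num

theorem conj_exp_I_mul (ω v : ℝ) :
    (starRingEnd ℂ) (Complex.exp (Complex.I * ω * v)) = Complex.exp (-(Complex.I * ω * v)) := by
  rw [← Complex.exp_conj]
  simp

/-- Under v = s² the Jacobian 2s cancels v^(-1/2) = 1/s and the factor 1/2; conjugation reverses the
sign of the phase. -/
theorem hasDerivAt_fresnelTail {ω s : ℝ} (hω : 0 < ω) (hs : 0 < s) :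
    HasDerivAt (fresnelTail ω) (Complex.exp (-(Complex.I * ω * (s ^ 2 : ℝ)))) s := by
  have h1 := hasDerivAt_oscTail (μ := 1 / 2) (by norm_num) hω (pow_pos hs 2)
  have h2 : HasDerivAt (fun s : ℝ => s ^ 2) (2 * s) s := by simpa using hasDerivAt_pow 2 s
  have h3 := (HasDerivAt.scomp (h := fun s : ℝ => s ^ 2) s h1 h2).star.const_mul (1 / 2 : ℂ)
  refine HasDerivAt.congr_deriv (f := fresnelTail ω) h3 ?_
  rw [sq_rpow_neg_half hs, ← conj_exp_I_mul]
  have : (s : ℂ) ≠ 0 := by exact_mod_cast hs.ne'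
  simp
  field_simp

theorem continuous_fresnelTail {ω : ℝ} (hω : 0 < ω) : Continuous (fresnelTail ω) := by
  refine continuous_const.mul (Complex.continuous_conj.comp ?_)
  exact (continuousOn_oscTail (by norm_num) (by norm_num) hω).comp_continuous (by fun_prop)
    fun s => sq_nonneg s

theorem norm_fresnelTail (ω s : ℝ) :
    ‖fresnelTail ω s‖ = 1 / 2 * ‖oscTail (1 / 2) ω (s ^ 2)‖ := by
  rw [fresnelTail, norm_mul, RCLike.norm_conj]
  norm_num

theorem norm_fresnelTail_le {ω : ℝ} (hω : 0 < ω) (s : ℝ) :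
    ‖fresnelTail ω s‖ ≤ Real.sqrt Real.pi / 2 * ω ^ (-(1 / 2 : ℝ)) := by
  have := norm_oscTail_le_Gamma (μ := 1 / 2) (by norm_num) (by norm_num) hω (s ^ 2)
  rw [Real.Gamma_one_half_eq] at this
  rw [norm_fresnelTail]
  linarith

theorem norm_fresnelTail_le_inv {ω s : ℝ} (hω : 0 < ω) (hs : 0 < s) :
    ‖fresnelTail ω s‖ ≤ 1 / 2 * (s⁻¹ * ω⁻¹) := by
  have := norm_oscTail_le (μ := 1 / 2) (by norm_num) hω (pow_pos hs 2)
  rw [sq_rpow_neg_half hs, div_eq_mul_inv (s⁻¹)] at this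
  rw [norm_fresnelTail]
  linarith

theorem fresnelTail_zero {ω : ℝ} (hω : 0 < ω) :
    fresnelTail ω 0 = -((Real.sqrt Real.pi : ℂ) / 2 * Complex.exp (-(Complex.I * (Real.pi / 4))) *
      ((ω ^ (-(1 / 2 : ℝ)) : ℝ) : ℂ)) := by
  have h := oscTail_zero (μ := 1 / 2) (by norm_num) hω
  have h2 : (starRingEnd ℂ) (Complex.exp (Complex.I * (Real.pi * ((1 / 2 : ℝ) : ℂ) / 2))) =
      Complex.exp (-(Complex.I * (Real.pi / 4))) := by
    rw [← Complex.exp_conj]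
    congr 1
    simp only [map_mul, map_div₀, Complex.conj_I, Complex.conj_ofReal, Complex.conj_ofNat]
    push_cast
    ring
  rw [fresnelTail, zero_pow two_ne_zero, h, map_neg, map_mul, h2, Complex.conj_ofReal,
    Real.Gamma_one_half_eq]
  push_cast
  ring

theorem rootK_pos : 0 < rootK := ((rootK_spec rootK).2 rfl).1

/-- Besides positivity, the only property of K that the estimates need: it makes (√π/2) K at least
the constant 1/2 of the decay bound. -/
theorem one_le_sqrt_pi_mul_rootK : 1 ≤ Real.sqrt Real.pi * rootK := by
  have hs : 0 < Real.sqrt Real.pi := Real.sqrt_pos.2 Real.pi_pos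
  have ht : 1 / 2 ≤ Real.sqrt (1 / 4 + Real.pi / 2) :=
    Real.le_sqrt_of_sq_le (by nlinarith [Real.pi_pos])
  rw [rootK, mul_div_cancel₀ _ hs.ne']
  linarith

theorem constL_nonneg (γ : ℝ) : 0 ≤ constL γ := by
  have := rootK_pos
  unfold constL
  positivity

/-- Interpolation between the uniform bound and the decay of the Fresnel tail. -/
theorem norm_fresnelTail_le_interp {ω s δ : ℝ} (hω : 0 < ω) (hs : 0 < s)
    (hδ : δ ∈ Set.Ioo (1 / 2 : ℝ) 1) :
    ‖fresnelTail ω s‖ ≤ constL (2 * δ - 1) * s ^ (-(2 * δ - 1)) * ω ^ (-δ) := by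
  obtain ⟨h1, h2⟩ := hδ
  set γ := 2 * δ - 1 with hγ
  have hπ : 0 < Real.sqrt Real.pi / 2 := by positivity [Real.sqrt_pos.2 Real.pi_pos]
  have hK := rootK_pos
  set N := ‖fresnelTail ω s‖ with hN
  have hN0 : 0 ≤ N := norm_nonneg _
  have hNa := norm_fresnelTail_le hω s
  have hNb : N ≤ Real.sqrt Real.pi / 2 * (rootK * s⁻¹ * ω⁻¹) := by
    refine (norm_fresnelTail_le_inv hω hs).trans ?_
    have : 0 < s⁻¹ * ω⁻¹ := by positivity
    nlinarith [one_le_sqrt_pi_mul_rootK]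
  -- The uniform bound is used with weight 1 - γ and the decay bound with weight γ; the power of ω
  -- is then -(1 - γ)/2 - γ = -δ.
  have e : N = N ^ (1 - γ) * N ^ γ := by
    rw [← Real.rpow_add_of_nonneg hN0 (by linarith) (by linarith)]
    simp
  rw [e]
  calc N ^ (1 - γ) * N ^ γ
      ≤ (Real.sqrt Real.pi / 2 * ω ^ (-(1 / 2 : ℝ))) ^ (1 - γ) *
        (Real.sqrt Real.pi / 2 * (rootK * s⁻¹ * ω⁻¹)) ^ γ := by
        gcongr
        · linarith
        · linarith
    _ = ((Real.sqrt Real.pi / 2) ^ (1 - γ) * (Real.sqrt Real.pi / 2) ^ γ) * rootK ^ γ *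
        s ^ (-γ) * ((ω ^ (-(1 / 2 : ℝ))) ^ (1 - γ) * ω⁻¹ ^ γ) := by
        rw [Real.mul_rpow hπ.le (by positivity), Real.mul_rpow hπ.le (by positivity),
          Real.mul_rpow (by positivity) (by positivity),
          Real.mul_rpow (by positivity) (by positivity), Real.rpow_neg hs.le, Real.inv_rpow hs.le]
        ring
    _ = _ := by
        rw [← Real.rpow_add hπ, sub_add_cancel, Real.rpow_one, ← Real.rpow_mul hω.le,
          ← Real.rpow_neg_one, ← Real.rpow_mul hω.le, ← Real.rpow_add hω, constL,
          show -(1 / 2) * (1 - γ) + -1 * γ = -δ by rw [hγ]; ring]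

/-- The error after the leading term is O(s⁻³ω⁻²) and also O(s⁻¹ω⁻¹); the geometric mean of the two
gives s⁻²ω^(-3/2), the order of error 6. -/
theorem norm_fresnelTail_add_le {ω s : ℝ} (hω : 0 < ω) (hs : 0 < s) :
    ‖fresnelTail ω s + Complex.exp (-(Complex.I * ω * (s ^ 2 : ℝ))) / (2 * Complex.I * ω * s)‖ ≤
      1 / 2 * (s ^ 2)⁻¹ * ω ^ (-(3 / 2 : ℝ)) := by
  have h1 := norm_oscTail_sub_le (μ := 1 / 2) (by norm_num) hω (pow_pos hs 2)
  have h2 := norm_oscTail_sub_le' (μ := 1 / 2) (by norm_num) hω (pow_pos hs 2)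
  set D := oscTail (1 / 2) ω (s ^ 2) - (((s ^ 2) ^ ((1 : ℝ) / 2 - 1) : ℝ) : ℂ) *
    Complex.exp (Complex.I * ω * (s ^ 2 : ℝ)) / (Complex.I * ω) with hD
  have hs' : (s : ℂ) ≠ 0 := by exact_mod_cast hs.ne'
  have hω' : (ω : ℂ) ≠ 0 := by exact_mod_cast hω.ne'
  have h3 : fresnelTail ω s +
      Complex.exp (-(Complex.I * ω * (s ^ 2 : ℝ))) / (2 * Complex.I * ω * s) =
      (1 / 2) * (starRingEnd ℂ) D := by
    rw [hD, map_sub, map_div₀, map_mul, conj_exp_I_mul, sq_rpow_neg_half hs, fresnelTail]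
    simp
    field_simp
    ring
  have hp : (s ^ 2) ^ ((1 : ℝ) / 2 - 2) = (s ^ 3)⁻¹ := by
    rw [← Real.rpow_natCast, ← Real.rpow_mul hs.le, ← Real.rpow_natCast, ← Real.rpow_neg hs.le]
    norm_num
  have h4 : (ω ^ (-(3 / 2 : ℝ))) ^ 2 = (ω ^ 3)⁻¹ := by
    rw [← Real.rpow_natCast, ← Real.rpow_mul hω.le, ← Real.rpow_natCast, ← Real.rpow_neg hω.le]
    norm_num
  rw [sq_rpow_neg_half hs] at h2
  rw [hp] at h1
  rw [h3, norm_mul, RCLike.norm_conj]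
  have h5 : ‖D‖ ^ 2 ≤ ((s ^ 2)⁻¹ * ω ^ (-(3 / 2 : ℝ))) ^ 2 := by
    rw [mul_pow, h4, sq]
    calc ‖D‖ * ‖D‖ ≤ ((1 - 1 / 2) * (s ^ 3)⁻¹ / ω ^ 2) * (2 * s⁻¹ / ω) := by gcongr
      _ = _ := by field_simp; ring
  have h6 := abs_le_of_sq_le_sq h5 (by positivity)
  have h7 := (le_abs_self _).trans h6
  norm_num
  linarith

/-! ### The two sides of the stationary point -/

/-- `u` is `C¹` on `[a, b]` with derivative `u'`, `|u| ≤ M` and `max |u| |u'| ≤ W`. -/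
structure BoundedC1 (a b M W : ℝ) (u u' : ℝ → ℂ) : Prop where
  cont : ContinuousOn u (Set.Icc a b)
  cont' : ContinuousOn u' (Set.Icc a b)
  hasDerivAt : ∀ p ∈ Set.Ioo a b, HasDerivAt u (u' p) p
  norm_le : ∀ p ∈ Set.Icc a b, ‖u p‖ ≤ M
  norm_le' : ∀ p ∈ Set.Icc a b, ‖u p‖ ≤ W
  norm_deriv_le : ∀ p ∈ Set.Icc a b, ‖u' p‖ ≤ W

/-- Integration by parts against the Fresnel kernel. -/
theorem norm_integral_fresnel_sub_le {ω δ b D : ℝ} {g g' : ℝ → ℂ} (hω : 0 < ω)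
    (hδ : δ ∈ Set.Ioo (1 / 2 : ℝ) 1) (hb : 0 ≤ b) (hg : ContinuousOn g (Set.Icc 0 b))
    (hg' : ContinuousOn g' (Set.Icc 0 b)) (hd : ∀ s ∈ Set.Ioo 0 b, HasDerivAt g (g' s) s)
    (hD : ∀ s ∈ Set.Icc 0 b, ‖g' s‖ ≤ D) :
    ‖(∫ s in (0 : ℝ)..b, g s * Complex.exp (-(Complex.I * ω * (s ^ 2 : ℝ)))) -
      (g b * fresnelTail ω b - g 0 * fresnelTail ω 0)‖ ≤
      D * (constL (2 * δ - 1) / (1 - (2 * δ - 1)) * b ^ (1 - (2 * δ - 1)) * ω ^ (-δ)) := by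
  have hIcc : Set.uIcc 0 b = Set.Icc 0 b := Set.uIcc_of_le hb
  have hD0 : 0 ≤ D := (norm_nonneg _).trans (hD 0 ⟨le_rfl, hb⟩)
  -- This is where δ < 1 enters: s^(-γ) is integrable at 0.
  have hγ : -1 < -(2 * δ - 1) := by linarith [hδ.2]
  have h := intervalIntegral.integral_mul_deriv_eq_deriv_mul_of_hasDeriv_right (a := 0) (b := b)
    (u := g) (v := fresnelTail ω) (u' := g')
    (v' := fun s => Complex.exp (-(Complex.I * ω * (s ^ 2 : ℝ))))
    (by rwa [hIcc]) (continuous_fresnelTail hω).continuousOn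
    (by
      rw [min_eq_left hb, max_eq_right hb]
      exact fun s hs => (hd s hs).hasDerivWithinAt)
    (by
      rw [min_eq_left hb, max_eq_right hb]
      exact fun s hs => (hasDerivAt_fresnelTail hω hs.1).hasDerivWithinAt)
    (ContinuousOn.intervalIntegrable (by rwa [hIcc]))
    (Continuous.intervalIntegrable (by fun_prop) _ _)
  rw [h, sub_sub_cancel_left, norm_neg]
  have hint : ∫ s in (0 : ℝ)..b, D * (constL (2 * δ - 1) * s ^ (-(2 * δ - 1)) * ω ^ (-δ)) =
      D * (constL (2 * δ - 1) / (1 - (2 * δ - 1)) * b ^ (1 - (2 * δ - 1)) * ω ^ (-δ)) := by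
    rw [intervalIntegral.integral_const_mul, intervalIntegral.integral_mul_const,
      intervalIntegral.integral_const_mul, integral_rpow (Or.inl hγ),
      Real.zero_rpow (by linarith), show -(2 * δ - 1) + 1 = 1 - (2 * δ - 1) by ring]
    ring
  rw [← hint]
  refine intervalIntegral.norm_integral_le_of_norm_le hb
    (Filter.Eventually.of_forall fun s hs => ?_)
    ((((intervalIntegral.intervalIntegrable_rpow' hγ).const_mul _).mul_const _).const_mul _)
  rw [norm_mul]
  exact mul_le_mul (hD s ⟨hs.1.le, hs.2⟩) (norm_fresnelTail_le_interp hω hs.1 hδ)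
    (norm_nonneg _) hD0

/-- The amplitude `x^(μ - 1) w(x)`. -/
def amp (μ : ℝ) (w : ℝ → ℂ) (x : ℝ) : ℂ := ((x ^ (μ - 1) : ℝ) : ℂ) * w x

/-- The derivative of `amp μ w`. -/
def ampDeriv (μ : ℝ) (w w' : ℝ → ℂ) (x : ℝ) : ℂ :=
  (((μ - 1) * x ^ (μ - 2) : ℝ) : ℂ) * w x + ((x ^ (μ - 1) : ℝ) : ℂ) * w' x

section

variable {P M W : ℝ} {w w' : ℝ → ℂ}

theorem continuousOn_rpow_ofReal {a P : ℝ} (ha : 0 < a) (r : ℝ) :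
    ContinuousOn (fun x : ℝ => ((x ^ r : ℝ) : ℂ)) (Set.Icc a P) :=
  Complex.continuous_ofReal.comp_continuousOn
    (continuousOn_id.rpow_const fun _ hx => Or.inl (ha.trans_le hx.1).ne')

theorem BoundedC1.continuousOn_amp (h : BoundedC1 0 P M W w w') (μ : ℝ) {a : ℝ} (ha : 0 < a) :
    ContinuousOn (amp μ w) (Set.Icc a P) :=
  (continuousOn_rpow_ofReal ha _).mul (h.cont.mono (Set.Icc_subset_Icc_left ha.le))

theorem BoundedC1.continuousOn_ampDeriv (h : BoundedC1 0 P M W w w') (μ : ℝ) {a : ℝ}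
    (ha : 0 < a) : ContinuousOn (ampDeriv μ w w') (Set.Icc a P) := by
  have hs := Set.Icc_subset_Icc_left (b := P) ha.le
  refine ContinuousOn.add (ContinuousOn.mul ?_ (h.cont.mono hs))
    ((continuousOn_rpow_ofReal ha _).mul (h.cont'.mono hs))
  simp only [Complex.ofReal_mul]
  exact continuousOn_const.mul (continuousOn_rpow_ofReal ha _)

theorem BoundedC1.hasDerivAt_amp (h : BoundedC1 0 P M W w w') (μ : ℝ) {x : ℝ}
    (hx : x ∈ Set.Ioo 0 P) : HasDerivAt (amp μ w) (ampDeriv μ w w' x) x := by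
  have h1 := (Real.hasDerivAt_rpow_const (p := μ - 1) (Or.inl hx.1.ne')).ofReal_comp
  rw [show μ - 1 - 1 = μ - 2 by ring] at h1
  exact h1.mul (h.hasDerivAt x hx)

theorem BoundedC1.norm_ampDeriv_le (h : BoundedC1 0 P M W w w') {μ : ℝ} (hμ : μ ≤ 1) {a x : ℝ}
    (ha : 0 < a) (hx : x ∈ Set.Icc a P) :
    ‖ampDeriv μ w w' x‖ ≤ (1 - μ) * a ^ (μ - 2) * W + a ^ (μ - 1) * W := by
  have hx' : x ∈ Set.Icc 0 P := ⟨ha.le.trans hx.1, hx.2⟩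
  have hx0 : 0 < x := ha.trans_le hx.1
  have hW : 0 ≤ W := (norm_nonneg _).trans (h.norm_le' x hx')
  refine (norm_add_le _ _).trans ?_
  rw [norm_mul, norm_mul, Complex.norm_real, Complex.norm_real, Real.norm_eq_abs,
    Real.norm_eq_abs, abs_mul, abs_of_nonpos (by linarith : μ - 1 ≤ 0),
    abs_of_pos (Real.rpow_pos_of_pos hx0 _), abs_of_pos (Real.rpow_pos_of_pos hx0 _), neg_sub]
  have h1 := Real.rpow_le_rpow_of_nonpos ha hx.1 (by linarith : μ - 1 ≤ 0)
  have h2 := Real.rpow_le_rpow_of_nonpos ha hx.1 (by linarith : μ - 2 ≤ 0)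
  have h3 := h.norm_le' x hx'
  have h4 := h.norm_deriv_le x hx'
  have h5 : 0 ≤ 1 - μ := by linarith
  gcongr

/-- With x = A + s the endpoint term at P vanishes with w(P). The interval has length P - A, which
is enlarged to P in the bound. -/
theorem BoundedC1.norm_integral_right_sub_le (h : BoundedC1 0 P M W w w') {A ω μ δ : ℝ}
    (hA : A ∈ Set.Ioo 0 P) (hP : w P = 0) (hμ : μ ≤ 1) (hω : 0 < ω)
    (hδ : δ ∈ Set.Ioo (1 / 2 : ℝ) 1) :
    ‖(∫ x in A..P, amp μ w x * Complex.exp (-(Complex.I * ω * ((x - A) ^ 2 : ℝ)))) +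
      amp μ w A * fresnelTail ω 0‖ ≤
      ((1 - μ) * A ^ (μ - 2) * W + A ^ (μ - 1) * W) *
        (constL (2 * δ - 1) / (1 - (2 * δ - 1)) * P ^ (1 - (2 * δ - 1)) * ω ^ (-δ)) := by
  obtain ⟨hA0, hAP⟩ := hA
  have hmap : Set.MapsTo (fun s => A + s) (Set.Icc 0 (P - A)) (Set.Icc A P) :=
    fun s hs => ⟨by linarith [hs.1], by linarith [hs.2]⟩
  have hγ : 0 < 1 - (2 * δ - 1) := by linarith [hδ.2]
  have hW : 0 ≤ W := (norm_nonneg _).trans (h.norm_le' A ⟨hA0.le, hAP.le⟩)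
  have h5 : 0 ≤ 1 - μ := by linarith
  have key := norm_integral_fresnel_sub_le (b := P - A) (g := fun s => amp μ w (A + s))
    (g' := fun s => ampDeriv μ w w' (A + s))
    (D := (1 - μ) * A ^ (μ - 2) * W + A ^ (μ - 1) * W) hω hδ (by linarith)
    ((h.continuousOn_amp μ hA0).comp (by fun_prop) hmap)
    ((h.continuousOn_ampDeriv μ hA0).comp (by fun_prop) hmap)
    (fun s hs => (h.hasDerivAt_amp μ
      ⟨by linarith [hs.1], by linarith [hs.2]⟩).comp_const_add A s)
    (fun s hs => h.norm_ampDeriv_le hμ hA0 (hmap hs))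
  have hsub := intervalIntegral.integral_comp_add_left (a := 0) (b := P - A)
    (fun x => amp μ w x * Complex.exp (-(Complex.I * ω * ((x - A) ^ 2 : ℝ)))) A
  simp only [add_sub_cancel_left, add_zero, add_sub_cancel] at hsub key
  have h0 : amp μ w P = 0 := by simp [amp, hP]
  rw [hsub, h0, zero_mul, zero_sub, sub_neg_eq_add] at key
  refine key.trans ?_
  have hL := constL_nonneg (2 * δ - 1)
  gcongr
  linarith

/-- The reflection x = A - s puts the stationary point at s = 0. Here x ≥ A/2, so the singularity at
0 costs only powers of A/2. -/
theorem BoundedC1.norm_integral_mid_sub_le (h : BoundedC1 0 P M W w w') {A ω μ δ : ℝ}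
    (hA : A ∈ Set.Ioo 0 P) (hμ : μ ≤ 1) (hω : 0 < ω) (hδ : δ ∈ Set.Ioo (1 / 2 : ℝ) 1) :
    ‖(∫ x in (A / 2)..A, amp μ w x * Complex.exp (-(Complex.I * ω * ((x - A) ^ 2 : ℝ)))) -
      (amp μ w (A / 2) * fresnelTail ω (A / 2) - amp μ w A * fresnelTail ω 0)‖ ≤
      ((1 - μ) * (A / 2) ^ (μ - 2) * W + (A / 2) ^ (μ - 1) * W) *
        (constL (2 * δ - 1) / (1 - (2 * δ - 1)) * (A / 2) ^ (1 - (2 * δ - 1)) * ω ^ (-δ)) := by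
  obtain ⟨hA0, hAP⟩ := hA
  have hmap : Set.MapsTo (fun s => A - s) (Set.Icc 0 (A / 2)) (Set.Icc (A / 2) P) :=
    fun s hs => ⟨by linarith [hs.2], by linarith [hs.1]⟩
  have key := norm_integral_fresnel_sub_le (b := A / 2) (g := fun s => amp μ w (A - s))
    (g' := fun s => -ampDeriv μ w w' (A - s))
    (D := (1 - μ) * (A / 2) ^ (μ - 2) * W + (A / 2) ^ (μ - 1) * W) hω hδ (by linarith)
    ((h.continuousOn_amp μ (half_pos hA0)).comp (by fun_prop) hmap)
    ((h.continuousOn_ampDeriv μ (half_pos hA0)).comp (by fun_prop) hmap).neg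
    (fun s hs => (h.hasDerivAt_amp μ
      ⟨by linarith [hs.2], by linarith [hs.1]⟩).comp_const_sub A s)
    (fun s hs => by
      rw [norm_neg]
      exact h.norm_ampDeriv_le hμ (half_pos hA0) (hmap hs))
  have hsub := intervalIntegral.integral_comp_sub_left (a := 0) (b := A / 2)
    (fun x => amp μ w x * Complex.exp (-(Complex.I * ω * ((x - A) ^ 2 : ℝ)))) A
  simp only [sub_sub_cancel_left, sub_zero, neg_sq, sub_half] at hsub key
  rwa [hsub] at key

/-! ### The neighbourhood of the singularity -/

/-- The factor `(2A - x)^(1 - μ) / (2 (A - x))` of the amplitude in the variable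
`v = x (2A - x)`. -/
def jac (A μ x : ℝ) : ℝ := (2 * A - x) ^ (1 - μ) / (2 * (A - x))

/-- The derivative of `jac A μ`. -/
def jacDeriv (A μ x : ℝ) : ℝ :=
  (2 * A - x) ^ (1 - μ) / (2 * (A - x) ^ 2) - (1 - μ) * (2 * A - x) ^ (-μ) / (2 * (A - x))

theorem hasDerivAt_jac {A μ x : ℝ} (hA : 0 < A) (hx : x < A) :
    HasDerivAt (jac A μ) (jacDeriv A μ x) x := by
  have h1 : HasDerivAt (fun x => 2 * A - x) (-1) x := (hasDerivAt_id x).const_sub _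
  have h2 := h1.rpow_const (p := 1 - μ) (Or.inl (by linarith))
  have h3 : HasDerivAt (fun x => 2 * (A - x)) (2 * -1) x :=
    ((hasDerivAt_id x).const_sub _).const_mul 2
  have h4 := h2.div h3 (by linarith)
  have hne : A - x ≠ 0 := by linarith
  refine HasDerivAt.congr_deriv (f := jac A μ) h4 ?_
  rw [jacDeriv, show 1 - μ - 1 = -μ by ring]
  field_simp
  ring

theorem continuousOn_jacDeriv {A μ : ℝ} (hA : 0 < A) :
    ContinuousOn (jacDeriv A μ) (Set.Icc 0 (A / 2)) := by
  have h1 (r : ℝ) : ContinuousOn (fun x : ℝ => (2 * A - x) ^ r) (Set.Icc 0 (A / 2)) :=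
    ContinuousOn.rpow_const (by fun_prop) fun x hx => Or.inl (by linarith [hx.2])
  have h2 (x : ℝ) (hx : x ∈ Set.Icc 0 (A / 2)) : A - x ≠ 0 := by linarith [hx.2]
  refine ContinuousOn.sub ((h1 _).div (by fun_prop) fun x hx => ?_)
    ((continuousOn_const.mul (h1 _)).div (by fun_prop) fun x hx => ?_)
  · exact mul_ne_zero two_ne_zero (pow_ne_zero 2 (h2 x hx))
  · exact mul_ne_zero two_ne_zero (h2 x hx)

theorem rpow_mul_jac {A μ x : ℝ} (hA : 0 < A) (hx : x ∈ Set.Icc 0 (A / 2)) :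
    (x * (2 * A - x)) ^ (μ - 1) * jac A μ x = x ^ (μ - 1) / (2 * (A - x)) := by
  have h1 : 0 < 2 * A - x := by linarith [hx.2]
  have h2 : (2 * A - x) ^ (μ - 1) * (2 * A - x) ^ (1 - μ) = 1 := by
    rw [← Real.rpow_add h1]
    simp
  rw [Real.mul_rpow hx.1 h1.le, jac, mul_assoc, ← mul_div_assoc, h2, mul_one_div]

theorem rpow_mul_jac_le {A μ x : ℝ} (hA : 0 < A) (hx : x ∈ Set.Icc 0 (A / 2)) :
    (x * (2 * A - x)) ^ (μ - 1) * jac A μ x ≤ x ^ (μ - 1) * A⁻¹ := by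
  rw [rpow_mul_jac hA hx, div_eq_mul_inv]
  have := Real.rpow_nonneg hx.1 (μ - 1)
  gcongr
  linarith [hx.2]

/-- After factoring out (2A - x)^(1-μ), which cancels against the kernel bound, the derivative is a
difference of two fractions. Since A - x ≥ A/2 and 2A - x ≥ A, both fractions lie between 0 and
2/A². -/
theorem rpow_mul_jacDeriv_le {A μ x : ℝ} (hμ : μ ≤ 1) (hA : 0 < A)
    (hx : x ∈ Set.Icc 0 (A / 2)) :
    (x * (2 * A - x)) ^ (μ - 1) * |jacDeriv A μ x| ≤ x ^ (μ - 1) * ((2 - μ) * (2 / A ^ 2)) := by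
  have h1 : 0 < 2 * A - x := by linarith [hx.2]
  have h3 : A / 2 ≤ A - x := by linarith [hx.2]
  have h4 : 0 < A - x := by linarith
  have h2 : (2 * A - x) ^ (μ - 1) * (2 * A - x) ^ (1 - μ) = 1 := by
    rw [← Real.rpow_add h1]
    simp
  have h5 : (2 * A - x) ^ (-μ) = (2 * A - x) ^ (1 - μ) / (2 * A - x) := by
    rw [← Real.rpow_sub_one h1.ne']
    congr 1
    ring
  have h6 : jacDeriv A μ x = (2 * A - x) ^ (1 - μ) *
      (1 / (2 * (A - x) ^ 2) - (1 - μ) * (1 / ((2 * A - x) * (2 * (A - x))))) := by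
    rw [jacDeriv, h5]
    field_simp
  rw [Real.mul_rpow hx.1 h1.le, h6, abs_mul, abs_of_pos (Real.rpow_pos_of_pos h1 _),
    mul_assoc, ← mul_assoc ((2 * A - x) ^ (μ - 1)), h2, one_mul]
  refine mul_le_mul_of_nonneg_left ?_ (Real.rpow_nonneg hx.1 _)
  have h7 : 1 / (2 * (A - x) ^ 2) ≤ 2 / A ^ 2 := by
    rw [div_le_div_iff₀ (by positivity) (by positivity)]
    nlinarith
  have h8 : 1 / ((2 * A - x) * (2 * (A - x))) ≤ 2 / A ^ 2 := by
    rw [div_le_div_iff₀ (by positivity) (by positivity)]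
    nlinarith
  have h9 : 0 ≤ 1 / (2 * (A - x) ^ 2) := by positivity
  have h10 : 0 ≤ 1 / ((2 * A - x) * (2 * (A - x))) := by positivity
  have h11 : 0 ≤ 2 / A ^ 2 := by positivity
  rw [abs_le]
  constructor <;> nlinarith

/-- The integration by parts is done in x, with `oscTail` composed with v = x(2A - x), so the
substitution is just the chain rule. The O(1/ω) bound on `oscTail` leaves x^(μ-1), integrable at 0.
-/
theorem BoundedC1.norm_integral_left_sub_le (h : BoundedC1 0 P M W w w') {A ω μ : ℝ}
    (hA : A ∈ Set.Ioo 0 P) (hμ : μ ∈ Set.Ioo (0 : ℝ) 1) (hω : 0 < ω) :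
    ‖(∫ x in (0 : ℝ)..(A / 2), amp μ w x * Complex.exp (-(Complex.I * ω * ((x - A) ^ 2 : ℝ)))) -
      Complex.exp (-(Complex.I * ω * (A ^ 2 : ℝ))) *
        ((jac A μ (A / 2) : ℂ) * w (A / 2) * oscTail μ ω (A / 2 * (2 * A - A / 2)) -
          (jac A μ 0 : ℂ) * w 0 * oscTail μ ω 0)‖ ≤
      ((2 - μ) * (2 / A ^ 2) * W + A⁻¹ * W) * ((A / 2) ^ μ / μ) * ω⁻¹ := by
  obtain ⟨hA0, hAP⟩ := hA
  obtain ⟨hμ0, hμ1⟩ := hμ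
  have hb : 0 ≤ A / 2 := by linarith
  have hIcc : Set.uIcc 0 (A / 2) = Set.Icc 0 (A / 2) := Set.uIcc_of_le hb
  have hsub : Set.Icc 0 (A / 2) ⊆ Set.Icc 0 P := Set.Icc_subset_Icc_right (by linarith)
  have hW : 0 ≤ W := (norm_nonneg _).trans (h.norm_le' 0 (hsub ⟨le_rfl, hb⟩))
  have hv (x : ℝ) : HasDerivAt (fun x => x * (2 * A - x)) (2 * (A - x)) x := by
    have := (hasDerivAt_id x).mul ((hasDerivAt_id x).const_sub (2 * A))
    refine HasDerivAt.congr_deriv (f := fun x => x * (2 * A - x)) this ?_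
    simp
    ring
  have hjc : ContinuousOn (fun x => (jac A μ x : ℂ)) (Set.Icc 0 (A / 2)) :=
    Complex.continuous_ofReal.comp_continuousOn fun x hx =>
      (hasDerivAt_jac hA0 (by linarith [hx.2])).continuousAt.continuousWithinAt
  have hjc' : ContinuousOn (fun x => (jacDeriv A μ x : ℂ)) (Set.Icc 0 (A / 2)) :=
    Complex.continuous_ofReal.comp_continuousOn (continuousOn_jacDeriv hA0)
  have hint : IntervalIntegrable (fun x : ℝ => x ^ (μ - 1)) volume 0 (A / 2) :=
    intervalIntegral.intervalIntegrable_rpow' (by linarith)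
  have hintC : IntervalIntegrable (fun x : ℝ => ((x ^ (μ - 1) : ℝ) : ℂ)) volume 0 (A / 2) :=
    ⟨hint.1.ofReal, hint.2.ofReal⟩
  have hIBP := intervalIntegral.integral_mul_deriv_eq_deriv_mul_of_hasDeriv_right
    (a := 0) (b := A / 2) (u := fun x => (jac A μ x : ℂ) * w x)
    (v := fun x => oscTail μ ω (x * (2 * A - x)))
    (u' := fun x => (jacDeriv A μ x : ℂ) * w x + (jac A μ x : ℂ) * w' x)
    (v' := fun x => (2 * (A - x)) • ((((x * (2 * A - x)) ^ (μ - 1) : ℝ) : ℂ) *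
      Complex.exp (Complex.I * ω * (x * (2 * A - x) : ℝ))))
    (by rw [hIcc]; exact hjc.mul (h.cont.mono hsub))
    (by
      rw [hIcc]
      refine (continuousOn_oscTail hμ1.le hμ0 hω).comp (by fun_prop) fun x hx => ?_
      exact mul_nonneg hx.1 (by linarith [hx.2]))
    (by
      rw [min_eq_left hb, max_eq_right hb]
      intro x hx
      exact ((hasDerivAt_jac hA0 (by linarith [hx.2])).ofReal_comp.mul
        (h.hasDerivAt x ⟨hx.1, by linarith [hx.2]⟩)).hasDerivWithinAt)
    (by
      rw [min_eq_left hb, max_eq_right hb]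
      intro x hx
      have hpos : 0 < x * (2 * A - x) := mul_pos hx.1 (by linarith [hx.2])
      exact (HasDerivAt.scomp (h := fun x => x * (2 * A - x)) x
        (hasDerivAt_oscTail hμ1.le hω hpos) (hv x)).hasDerivWithinAt)
    (by
      refine ContinuousOn.intervalIntegrable ?_
      rw [hIcc]
      exact (hjc'.mul (h.cont.mono hsub)).add (hjc.mul (h.cont'.mono hsub)))
    (by
      -- The kernel is the integrable x^(μ-1) times this continuous function.
      have hc : ContinuousOn (fun x : ℝ => (((2 * A - x) ^ (μ - 1) * (2 * (A - x)) : ℝ) : ℂ) *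
          Complex.exp (Complex.I * ω * (x * (2 * A - x) : ℝ))) (Set.uIcc 0 (A / 2)) := by
        rw [hIcc]
        refine ContinuousOn.mul (Complex.continuous_ofReal.comp_continuousOn
          (ContinuousOn.mul (ContinuousOn.rpow_const (by fun_prop) fun x hx =>
            Or.inl (by linarith [hx.2])) (by fun_prop))) (by fun_prop)
      refine (hintC.mul_continuousOn hc).congr fun x hx => ?_
      rw [Set.uIoc_of_le hb] at hx
      simp only [Complex.real_smul]
      rw [Real.mul_rpow hx.1.le (by linarith [hx.2])]
      push_cast
      ring)
  have hL : (∫ x in (0 : ℝ)..(A / 2),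
      amp μ w x * Complex.exp (-(Complex.I * ω * ((x - A) ^ 2 : ℝ)))) =
      Complex.exp (-(Complex.I * ω * (A ^ 2 : ℝ))) * ∫ x in (0 : ℝ)..(A / 2),
        (jac A μ x : ℂ) * w x * ((2 * (A - x)) • ((((x * (2 * A - x)) ^ (μ - 1) : ℝ) : ℂ) *
      Complex.exp (Complex.I * ω * (x * (2 * A - x) : ℝ)))) := by
    rw [← intervalIntegral.integral_const_mul]
    refine intervalIntegral.integral_congr fun x hx => ?_
    rw [hIcc] at hx
    have hne : A - x ≠ 0 := by linarith [hx.2]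
    have h1 : x ^ (μ - 1) = (x * (2 * A - x)) ^ (μ - 1) * jac A μ x * (2 * (A - x)) := by
      rw [rpow_mul_jac hA0 hx]
      field_simp
    -- Completing the square: -(x - A)² = -A² + x(2A - x).
    have h2 : Complex.exp (-(Complex.I * ω * ((x - A) ^ 2 : ℝ))) =
        Complex.exp (-(Complex.I * ω * (A ^ 2 : ℝ))) *
          Complex.exp (Complex.I * ω * (x * (2 * A - x) : ℝ)) := by
      rw [← Complex.exp_add]
      congr 1
      push_cast
      ring
    simp only [amp, Complex.real_smul]
    rw [h1, h2]
    push_cast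
    ring
  rw [hL, hIBP, ← mul_sub]
  simp only [zero_mul, sub_sub_cancel_left]
  have hnexp : ‖Complex.exp (-(Complex.I * ω * (A ^ 2 : ℝ)))‖ = 1 := by
    rw [← conj_exp_I_mul, RCLike.norm_conj, norm_exp_I_mul]
  rw [norm_mul, hnexp, one_mul, norm_neg]
  have hint2 : ∫ x in (0 : ℝ)..(A / 2),
      x ^ (μ - 1) * (((2 - μ) * (2 / A ^ 2) * W + A⁻¹ * W) * ω⁻¹) =
      ((2 - μ) * (2 / A ^ 2) * W + A⁻¹ * W) * ((A / 2) ^ μ / μ) * ω⁻¹ := by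
    rw [intervalIntegral.integral_mul_const, integral_rpow (Or.inl (by linarith)), sub_add_cancel,
      Real.zero_rpow hμ0.ne']
    ring
  rw [← hint2]
  refine intervalIntegral.norm_integral_le_of_norm_le hb
    (Filter.Eventually.of_forall fun x hx => ?_) (hint.mul_const _)
  have hx' : x ∈ Set.Icc 0 (A / 2) := ⟨hx.1.le, hx.2⟩
  have hpos : 0 < x * (2 * A - x) := mul_pos hx.1 (by linarith [hx.2])
  have hj0 : 0 ≤ jac A μ x :=
    div_nonneg (Real.rpow_nonneg (by linarith [hx.2]) _) (by linarith [hx.2])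
  have hG := norm_oscTail_le hμ1.le hω hpos
  have hn : ‖(jacDeriv A μ x : ℂ) * w x + (jac A μ x : ℂ) * w' x‖ ≤
      |jacDeriv A μ x| * W + jac A μ x * W := by
    refine (norm_add_le _ _).trans ?_
    rw [norm_mul, norm_mul, Complex.norm_real, Complex.norm_real, Real.norm_eq_abs,
      Real.norm_of_nonneg hj0]
    gcongr
    · exact h.norm_le' x (hsub hx')
    · exact h.norm_deriv_le x (hsub hx')
  rw [norm_mul]
  calc _ ≤ (|jacDeriv A μ x| * W + jac A μ x * W) * ((x * (2 * A - x)) ^ (μ - 1) / ω) := by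
        gcongr
    _ = ((x * (2 * A - x)) ^ (μ - 1) * |jacDeriv A μ x| * W +
        (x * (2 * A - x)) ^ (μ - 1) * jac A μ x * W) * ω⁻¹ := by ring
    _ ≤ (x ^ (μ - 1) * ((2 - μ) * (2 / A ^ 2)) * W + x ^ (μ - 1) * A⁻¹ * W) * ω⁻¹ := by
        exact mul_le_mul_of_nonneg_right (add_le_add
          (mul_le_mul_of_nonneg_right (rpow_mul_jacDeriv_le hμ1.le hA0 hx') hW)
          (mul_le_mul_of_nonneg_right (rpow_mul_jac_le hA0 hx') hW)) (inv_nonneg.2 hω.le)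
    _ = _ := by ring

end

/-! ### Cancellation at the midpoint and assembly -/

section

variable {P M W : ℝ} {w w' : ℝ → ℂ}

theorem norm_exp_neg_I_mul (ω v : ℝ) : ‖Complex.exp (-(Complex.I * ω * v))‖ = 1 := by
  rw [← conj_exp_I_mul, RCLike.norm_conj, norm_exp_I_mul]

/-- The boundary terms at the midpoint cancel to leading order. -/
theorem norm_midpoint_boundary_le {A ω μ : ℝ} (hA : 0 < A) (hμ : μ ≤ 1) (hω : 0 < ω)
    (hM : ‖w (A / 2)‖ ≤ M) :
    ‖Complex.exp (-(Complex.I * ω * (A ^ 2 : ℝ))) *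
        ((jac A μ (A / 2) : ℂ) * w (A / 2) * oscTail μ ω (A / 2 * (2 * A - A / 2))) +
      amp μ w (A / 2) * fresnelTail ω (A / 2)‖ ≤
      (A / 2) ^ (μ - 1) / (A * (3 * A ^ 2 / 4)) * (1 - μ) * M / ω ^ 2 +
        (A / 2) ^ (μ - 1) * (1 / 2 * ((A / 2) ^ 2)⁻¹ * ω ^ (-(3 / 2 : ℝ))) * M := by
  have hA2 : 0 < A / 2 := half_pos hA
  have hM0 : 0 ≤ M := (norm_nonneg _).trans hM
  set V := A / 2 * (2 * A - A / 2) with hV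
  have hV' : V = 3 * A ^ 2 / 4 := by rw [hV]; ring
  have hVpos : 0 < V := by rw [hV']; positivity
  have hj : V ^ (μ - 1) * jac A μ (A / 2) = (A / 2) ^ (μ - 1) / A := by
    rw [hV, rpow_mul_jac hA ⟨hA2.le, le_rfl⟩]
    congr 1
    ring
  have hj0 : 0 ≤ jac A μ (A / 2) :=
    div_nonneg (Real.rpow_nonneg (by linarith) _) (by linarith)
  have hAc : (A : ℂ) ≠ 0 := by exact_mod_cast hA.ne'
  have hωc : (ω : ℂ) ≠ 0 := by exact_mod_cast hω.ne'
  have hexp : Complex.exp (-(Complex.I * ω * (A ^ 2 : ℝ))) * Complex.exp (Complex.I * ω * V) =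
      Complex.exp (-(Complex.I * ω * ((A / 2) ^ 2 : ℝ))) := by
    rw [← Complex.exp_add, hV']
    congr 1
    push_cast
    ring
  have hjC : ((V ^ (μ - 1) : ℝ) : ℂ) * jac A μ (A / 2) = (((A / 2) ^ (μ - 1) : ℝ) : ℂ) / A := by
    exact_mod_cast congrArg Complex.ofReal hj
  have hsplit : Complex.exp (-(Complex.I * ω * (A ^ 2 : ℝ))) *
        ((jac A μ (A / 2) : ℂ) * w (A / 2) * oscTail μ ω V) +
      amp μ w (A / 2) * fresnelTail ω (A / 2) =
      Complex.exp (-(Complex.I * ω * (A ^ 2 : ℝ))) * ((jac A μ (A / 2) : ℂ) * w (A / 2) *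
        (oscTail μ ω V - ((V ^ (μ - 1) : ℝ) : ℂ) * Complex.exp (Complex.I * ω * V) /
          (Complex.I * ω))) +
      amp μ w (A / 2) * (fresnelTail ω (A / 2) +
        Complex.exp (-(Complex.I * ω * ((A / 2) ^ 2 : ℝ))) /
          (2 * Complex.I * ω * (A / 2 : ℝ))) := by
    -- Both leading terms come from one integration by parts of the same integrand at A/2, once from
    -- each side, so they agree; in formulas, -A² + V = -(A/2)² and 2(A - A/2) = A.
    have hcancel : Complex.exp (-(Complex.I * ω * (A ^ 2 : ℝ))) *
        ((jac A μ (A / 2) : ℂ) * w (A / 2) *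
        (((V ^ (μ - 1) : ℝ) : ℂ) * Complex.exp (Complex.I * ω * V) / (Complex.I * ω))) =
        amp μ w (A / 2) * (Complex.exp (-(Complex.I * ω * ((A / 2) ^ 2 : ℝ))) /
          (2 * Complex.I * ω * (A / 2 : ℝ))) := by
      rw [amp, ← hexp]
      have e : 2 * Complex.I * ω * ((A / 2 : ℝ) : ℂ) = A * (Complex.I * ω) := by
        push_cast
        ring
      rw [e]
      calc _ = Complex.exp (-(Complex.I * ω * (A ^ 2 : ℝ))) * Complex.exp (Complex.I * ω * V) *
            w (A / 2) * (((V ^ (μ - 1) : ℝ) : ℂ) * jac A μ (A / 2)) / (Complex.I * ω) := by ring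
        _ = _ := by rw [hjC]; field_simp
    linear_combination hcancel
  rw [hsplit]
  refine (norm_add_le _ _).trans (add_le_add ?_ ?_)
  · rw [norm_mul, norm_exp_neg_I_mul, one_mul, norm_mul, norm_mul, Complex.norm_real,
      Real.norm_of_nonneg hj0]
    have h1 := norm_oscTail_sub_le hμ hω hVpos
    have h2 : V ^ (μ - 2) = V ^ (μ - 1) / V := by
      rw [← Real.rpow_sub_one hVpos.ne']
      congr 1
      ring
    have h3 : 0 ≤ 1 - μ := by linarith
    calc _ ≤ jac A μ (A / 2) * M * ((1 - μ) * V ^ (μ - 2) / ω ^ 2) := by gcongr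
      _ = (V ^ (μ - 1) * jac A μ (A / 2)) / V * (1 - μ) * M / ω ^ 2 := by rw [h2]; ring
      _ = _ := by rw [hj, hV', div_div]
  · rw [norm_mul, amp, norm_mul, Complex.norm_real, Real.norm_of_nonneg (by positivity)]
    have h1 := norm_fresnelTail_add_le hω hA2
    calc _ ≤ (A / 2) ^ (μ - 1) * M * (1 / 2 * ((A / 2) ^ 2)⁻¹ * ω ^ (-(3 / 2 : ℝ))) := by gcongr
      _ = _ := by ring

theorem BoundedC1.intervalIntegrable_amp_mul (h : BoundedC1 0 P M W w w') (hP : 0 ≤ P) {μ : ℝ}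
    (hμ : 0 < μ) {e : ℝ → ℂ} (he : Continuous e) {a b : ℝ} (ha : a ∈ Set.Icc 0 P)
    (hb : b ∈ Set.Icc 0 P) : IntervalIntegrable (fun x => amp μ w x * e x) volume a b := by
  have h1 : IntervalIntegrable (fun x : ℝ => x ^ (μ - 1)) volume 0 P :=
    intervalIntegral.intervalIntegrable_rpow' (by linarith)
  have h2 : IntervalIntegrable (fun x : ℝ => ((x ^ (μ - 1) : ℝ) : ℂ)) volume 0 P :=
    ⟨h1.1.ofReal, h1.2.ofReal⟩
  have h3 := (h2.mul_continuousOn (by rw [Set.uIcc_of_le hP]; exact h.cont)).mul_continuousOn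
    he.continuousOn
  exact h3.mono_set (by rw [Set.uIcc_of_le hP]; exact Set.uIcc_subset_Icc ha hb)

theorem BoundedC1.norm_integral_sub_le (h : BoundedC1 0 P M W w w') {A ω μ δ : ℝ}
    (hA : A ∈ Set.Ioo 0 P) (hP : w P = 0) (hμ : μ ∈ Set.Ioo (0 : ℝ) 1) (hω : 0 < ω)
    (hδ : δ ∈ Set.Ioo (1 / 2 : ℝ) 1) :
    ‖(∫ x in (0 : ℝ)..P, amp μ w x * Complex.exp (-(Complex.I * ω * ((x - A) ^ 2 : ℝ)))) -
      (-(2 * amp μ w A * fresnelTail ω 0) -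
        Complex.exp (-(Complex.I * ω * (A ^ 2 : ℝ))) *
          ((jac A μ 0 : ℂ) * w 0 * oscTail μ ω 0))‖ ≤
      ((2 - μ) * (2 / A ^ 2) * W + A⁻¹ * W) * ((A / 2) ^ μ / μ) * ω⁻¹ +
      ((A / 2) ^ (μ - 1) / (A * (3 * A ^ 2 / 4)) * (1 - μ) * M / ω ^ 2 +
        (A / 2) ^ (μ - 1) * (1 / 2 * ((A / 2) ^ 2)⁻¹ * ω ^ (-(3 / 2 : ℝ))) * M) +
      ((1 - μ) * (A / 2) ^ (μ - 2) * W + (A / 2) ^ (μ - 1) * W) *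
        (constL (2 * δ - 1) / (1 - (2 * δ - 1)) * (A / 2) ^ (1 - (2 * δ - 1)) * ω ^ (-δ)) +
      ((1 - μ) * A ^ (μ - 2) * W + A ^ (μ - 1) * W) *
        (constL (2 * δ - 1) / (1 - (2 * δ - 1)) * P ^ (1 - (2 * δ - 1)) * ω ^ (-δ)) := by
  have h1 := h.norm_integral_left_sub_le hA hμ hω
  have h2 := norm_midpoint_boundary_le (w := w) hA.1 hμ.2.le hω
    (h.norm_le (A / 2) ⟨by linarith [hA.1], by linarith [hA.1, hA.2]⟩)
  have h3 := h.norm_integral_mid_sub_le hA hμ.2.le hω hδ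
  have h4 := h.norm_integral_right_sub_le hA hP hμ.2.le hω hδ
  have hP0 : 0 ≤ P := by linarith [hA.1, hA.2]
  have he : Continuous fun x : ℝ => Complex.exp (-(Complex.I * ω * ((x - A) ^ 2 : ℝ))) := by
    fun_prop
  have m0 : (0 : ℝ) ∈ Set.Icc 0 P := ⟨le_rfl, hP0⟩
  have m1 : A / 2 ∈ Set.Icc 0 P := ⟨by linarith [hA.1], by linarith [hA.1, hA.2]⟩
  have m2 : A ∈ Set.Icc 0 P := ⟨hA.1.le, hA.2.le⟩
  have m3 : P ∈ Set.Icc 0 P := ⟨hP0, le_rfl⟩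
  have hI := intervalIntegral.integral_add_adjacent_intervals
    (h.intervalIntegrable_amp_mul hP0 hμ.1 he m0 m1)
    (h.intervalIntegrable_amp_mul hP0 hμ.1 he m1 m2)
  have hI' := intervalIntegral.integral_add_adjacent_intervals
    (h.intervalIntegrable_amp_mul hP0 hμ.1 he m0 m2)
    (h.intervalIntegrable_amp_mul hP0 hμ.1 he m2 m3)
  rw [← hI', ← hI]
  -- The midpoint terms of the left and middle pieces are grouped into one summand; the two halves
  -- at A add up to the factor 2.
  refine le_trans (le_of_eq ?_) ((norm_add_le _ _).trans (add_le_add ((norm_add_le _ _).trans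
    (add_le_add ((norm_add_le _ _).trans (add_le_add h1 h2)) h3)) h4))
  congr 1
  ring

end

/-! ### Comparison with the eight explicit constants -/

theorem REq_eq (p₁ p₂ μ δ : ℝ) (u : ℝ → ℂ) : REq p₁ p₂ μ δ u =
    ![(2 : ℝ) ^ (2 - μ) / μ * (2 - μ) * normW1inf p₁ p₂ u,
    (2 : ℝ) ^ (1 - μ) / μ * normW1inf p₁ p₂ u,
    (1 - μ) * ((2 : ℝ) ^ (3 - μ) / 3) * normLinf p₁ p₂ u,
    constL (2 * δ - 1) / (1 - (2 * δ - 1)) * (2 : ℝ) ^ (2 - μ) * (1 - μ) * normW1inf p₁ p₂ u,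
    constL (2 * δ - 1) / (1 - (2 * δ - 1)) * (2 : ℝ) ^ (1 - μ) * normW1inf p₁ p₂ u,
    Real.sqrt Real.pi / (2 : ℝ) ^ (μ - 2) * normLinf p₁ p₂ u,
    constL (2 * δ - 1) / (1 - (2 * δ - 1)) * (1 - μ) * (p₂ - p₁) ^ (1 - (2 * δ - 1)) *
      normW1inf p₁ p₂ u,
    constL (2 * δ - 1) / (1 - (2 * δ - 1)) * (p₂ - p₁) ^ (1 - (2 * δ - 1)) *
      normW1inf p₁ p₂ u] := by
  ext k
  fin_cases k <;> rfl

theorem αEq_eq (μ δ : ℝ) : αEq μ δ =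
    ![2 - μ, 1 - μ, 4 - μ, -μ + 1 + (2 * δ - 1), (2 * δ - 1) - μ, 3 - μ, 2 - μ, 1 - μ] := by
  ext k
  fin_cases k <;> rfl

theorem βEq_eq (δ : ℝ) : βEq δ = ![1, 1, 2, δ, δ, 3 / 2, δ, δ] := by
  ext k
  fin_cases k <;> rfl

/-- The explicit remainder is dominated by the sum of the eight error terms. -/
theorem remainder_le_sum {p₁ p₂ A ω μ δ : ℝ} {u : ℝ → ℂ} (hA : 0 < A)
    (hμ : μ ∈ Set.Ioo (0 : ℝ) 1) (hω : 0 < ω) (hδ : δ ∈ Set.Ioo (1 / 2 : ℝ) 1)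
    (hM : 0 ≤ normLinf p₁ p₂ u) :
      ((2 - μ) * (2 / A ^ 2) * normW1inf p₁ p₂ u + A⁻¹ * normW1inf p₁ p₂ u) *
        ((A / 2) ^ μ / μ) * ω⁻¹ +
      ((A / 2) ^ (μ - 1) / (A * (3 * A ^ 2 / 4)) * (1 - μ) * normLinf p₁ p₂ u / ω ^ 2 +
        (A / 2) ^ (μ - 1) * (1 / 2 * ((A / 2) ^ 2)⁻¹ * ω ^ (-(3 / 2 : ℝ))) *
          normLinf p₁ p₂ u) +
      ((1 - μ) * (A / 2) ^ (μ - 2) * normW1inf p₁ p₂ u +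
          (A / 2) ^ (μ - 1) * normW1inf p₁ p₂ u) *
        (constL (2 * δ - 1) / (1 - (2 * δ - 1)) * (A / 2) ^ (1 - (2 * δ - 1)) * ω ^ (-δ)) +
      ((1 - μ) * A ^ (μ - 2) * normW1inf p₁ p₂ u + A ^ (μ - 1) * normW1inf p₁ p₂ u) *
        (constL (2 * δ - 1) / (1 - (2 * δ - 1)) * (p₂ - p₁) ^ (1 - (2 * δ - 1)) * ω ^ (-δ)) ≤
      ∑ k : Fin 8, REq p₁ p₂ μ δ u k * A ^ (-αEq μ δ k) * ω ^ (-βEq δ k) := by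
  rw [REq_eq, αEq_eq, βEq_eq]
  obtain ⟨hμ0, hμ1⟩ := hμ
  obtain ⟨hδ0, hδ1⟩ := hδ
  have hW : 0 ≤ normW1inf p₁ p₂ u := hM.trans (le_max_left _ _)
  have hL := constL_nonneg (2 * δ - 1)
  simp only [Fin.sum_univ_eight, Matrix.cons_val]
  generalize normW1inf p₁ p₂ u = W at *
  generalize normLinf p₁ p₂ u = M at *
  set γ := 2 * δ - 1 with hγ
  have hγ0 : 0 < 1 - γ := by linarith
  generalize (p₂ - p₁) ^ (1 - γ) = B
  have hC : 0 ≤ constL γ / (1 - γ) := div_nonneg hL hγ0.le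
  generalize constL γ / (1 - γ) = C at *
  have hX : 0 < A ^ μ := by positivity
  have hY : 0 < (2 : ℝ) ^ μ := by positivity
  have hG : 0 < A ^ γ := by positivity
  have hg : 0 < (2 : ℝ) ^ γ := by positivity
  have hg2 : (2 : ℝ) ^ γ ≤ 2 := by
    simpa using Real.rpow_le_rpow_of_exponent_le (x := 2) (by norm_num) (by linarith : γ ≤ 1)
  have hsqrt : 1 ≤ Real.sqrt Real.pi := Real.one_le_sqrt.2 (by linarith [Real.pi_gt_three])
  have hT : 0 < ω ^ (-(3 / 2 : ℝ)) := by positivity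
  have hD : 0 < ω ^ (-δ) := by positivity
  have a2 (x : ℝ) (hx : 0 < x) (r : ℝ) : x ^ (r - 2) = x ^ r / x ^ 2 := by
    exact_mod_cast Real.rpow_sub_natCast hx.ne' r 2
  have a3 (x : ℝ) (hx : 0 < x) (r : ℝ) : x ^ (r - 3) = x ^ r / x ^ 3 := by
    exact_mod_cast Real.rpow_sub_natCast hx.ne' r 3
  have a4 (x : ℝ) (hx : 0 < x) (r : ℝ) : x ^ (r - 4) = x ^ r / x ^ 4 := by
    exact_mod_cast Real.rpow_sub_natCast hx.ne' r 4
  have b1 (x : ℝ) (hx : 0 < x) (r : ℝ) : x ^ (1 - r) = x / x ^ r := by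
    rw [Real.rpow_sub hx, Real.rpow_one]
  have b2 : (2 : ℝ) ^ (2 - μ) = 4 / 2 ^ μ := by
    rw [Real.rpow_sub two_pos, Real.rpow_two]
    norm_num
  have b3 : (2 : ℝ) ^ (3 - μ) = 8 / 2 ^ μ := by
    rw [Real.rpow_sub two_pos]
    norm_num
  have c1 : A ^ (-(-μ + 1 + γ)) = A ^ μ / (A * A ^ γ) := by
    rw [show -(-μ + 1 + γ) = μ - (1 + γ) by ring, Real.rpow_sub hA, Real.rpow_add hA,
      Real.rpow_one]
  have c2 : A ^ (-(γ - μ)) = A ^ μ / A ^ γ := by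
    rw [neg_sub, Real.rpow_sub hA]
  have w1 : ω ^ (-(1 : ℝ)) = ω⁻¹ := Real.rpow_neg_one ω
  have w2 : ω ^ (-(2 : ℝ)) = (ω ^ 2)⁻¹ := by rw [Real.rpow_neg hω.le, Real.rpow_two]
  have hA2 : 0 < A / 2 := half_pos hA
  rw [c1, c2, w1, w2, b2, b3]
  simp only [neg_sub, a2 A hA, a3 A hA, a4 A hA, a2 2 two_pos, a2 _ hA2, b1 _ hA2, b1 2 two_pos,
    Real.rpow_sub_one hA.ne', Real.rpow_sub_one hA2.ne',
    Real.div_rpow hA.le (zero_le_two : (0 : ℝ) ≤ 2)]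
  generalize A ^ μ = X at *
  generalize (2 : ℝ) ^ μ = Y at *
  generalize A ^ γ = G at *
  generalize (2 : ℝ) ^ γ = g at *
  generalize ω ^ (-(3 / 2 : ℝ)) = T at *
  generalize ω ^ (-δ) = D at *
  generalize Real.sqrt Real.pi = s at *
  have h1μ : 0 < 1 - μ := by linarith
  have h2μ : 0 < 2 - μ := by linarith
  have t1 : 0 ≤ 4 / Y / μ * (2 - μ) * W * (X / A ^ 2) * ω⁻¹ := by positivity
  have t2 : 0 ≤ 2 / Y / μ * W * (X / A) * ω⁻¹ := by positivity
  have t4 : 0 ≤ C * (2 / Y) * (1 - μ) * W * (X / (A * G)) * D * (2 - g) :=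
    mul_nonneg (by positivity) (by linarith)
  have t5 : 0 ≤ C * (1 / Y) * W * (X / G) * D * (2 - g) :=
    mul_nonneg (by positivity) (by linarith)
  have t6 : 0 ≤ (4 / Y) * M * (X / A ^ 3) * T * (s - 1) :=
    mul_nonneg (by positivity) (by linarith)
  rw [← sub_nonneg]
  -- The exact slack: errors 1 and 2 are overestimated by a factor 2, errors 4 and 5 replace 2^γ by
  -- 2, error 6 carries an extra √π ≥ 1, and errors 3, 7, 8 are sharp for this remainder.
  refine le_of_le_of_eq (b := (1 / 2) * (4 / Y / μ * (2 - μ) * W * (X / A ^ 2) * ω⁻¹) +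
    (1 / 2) * (2 / Y / μ * W * (X / A) * ω⁻¹) +
    C * (2 / Y) * (1 - μ) * W * (X / (A * G)) * D * (2 - g) +
    C * (1 / Y) * W * (X / G) * D * (2 - g) + (4 / Y) * M * (X / A ^ 3) * T * (s - 1))
    (by linarith) ?_
  field_simp
  ring

/-! ### Norms and the passage from `U` to the shifted amplitude -/

theorem normLinf_congr {a b : ℝ} {f g : ℝ → ℂ} (h : Set.EqOn f g (Set.Ioo a b)) :
    normLinf a b f = normLinf a b g := by
  unfold normLinf
  congr 1
  exact eLpNorm_congr_ae ((ae_restrict_iff' measurableSet_Ioo).2 (Filter.Eventually.of_forall h))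

theorem normLinf_nonneg (a b : ℝ) (f : ℝ → ℂ) : 0 ≤ normLinf a b f := ENNReal.toReal_nonneg

/-- A continuous function obeys its essential bound everywhere on the open interval, then on its
closure. -/
theorem norm_le_normLinf {a b : ℝ} {f : ℝ → ℂ} (hab : a < b)
    (hf : ContinuousOn f (Set.Icc a b)) : ∀ p ∈ Set.Icc a b, ‖f p‖ ≤ normLinf a b f := by
  obtain ⟨C, hC⟩ := isCompact_Icc.exists_bound_of_continuousOn hf
  have hfin : eLpNormEssSup f (volume.restrict (Set.Ioo a b)) < ⊤ :=
    eLpNormEssSup_lt_top_of_ae_bound (C := C) ((ae_restrict_iff' measurableSet_Ioo).2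
      (Filter.Eventually.of_forall fun x hx => hC x (Set.Ioo_subset_Icc_self hx)))
  have hae : ∀ᵐ p ∂(volume.restrict (Set.Ioo a b)), ‖f p‖ ≤ normLinf a b f := by
    filter_upwards [ae_le_eLpNormEssSup (f := f) (μ := volume.restrict (Set.Ioo a b))] with p hp
    rw [normLinf, eLpNorm_exponent_top]
    simpa using ENNReal.toReal_mono hfin.ne hp
  have hfo : ContinuousOn (fun p => ‖f p‖) (Set.Ioo a b) :=
    (hf.mono Set.Ioo_subset_Icc_self).norm
  -- The inequality is encoded as equality of two continuous functions, which spreads from almost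
  -- everywhere to everywhere on an open set.
  have heq := Measure.eqOn_open_of_ae_eq (f := fun p => min ‖f p‖ (normLinf a b f))
    (g := fun p => ‖f p‖) (hae.mono fun p hp => min_eq_left hp) isOpen_Ioo
    (hfo.inf continuousOn_const) hfo
  have hcl := closure_Ioo hab.ne
  intro p hp
  refine le_on_closure (s := Set.Ioo a b) (f := fun p => ‖f p‖) (g := fun _ => normLinf a b f)
    (fun x hx => min_eq_left_iff.1 (heq hx)) ?_ continuousOn_const (hcl ▸ hp)
  rw [hcl]
  exact hf.norm

section

variable {p₁ p₂ p₀ c μ δ : ℝ} {U u : ℝ → ℂ}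

/-- The derivative within the closed interval is continuous up to the endpoints, where `deriv u` is
not controlled; the two agree inside, so the norms coincide. -/
theorem IsAmplitude.boundedC1 (hU : IsAmplitude p₁ p₂ μ 1 1 U u) (h12 : p₁ < p₂) :
    BoundedC1 0 (p₂ - p₁) (normLinf p₁ p₂ u) (normW1inf p₁ p₂ u) (fun x => u (p₁ + x))
      (fun x => derivWithin u (Set.Icc p₁ p₂) (p₁ + x)) := by
  have hu : ContDiffOn ℝ 1 u (Set.Icc p₁ p₂) := by exact_mod_cast hU.contDiffOn
  have hc := hu.continuousOn
  have hc' := hu.continuousOn_derivWithin (uniqueDiffOn_Icc h12) le_rfl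
  have hmap : Set.MapsTo (fun x => p₁ + x) (Set.Icc 0 (p₂ - p₁)) (Set.Icc p₁ p₂) :=
    fun x hx => ⟨by linarith [hx.1], by linarith [hx.2]⟩
  have hnhds {p : ℝ} (hp : p ∈ Set.Ioo p₁ p₂) : Set.Icc p₁ p₂ ∈ 𝓝 p := Icc_mem_nhds hp.1 hp.2
  have heq : normLinf p₁ p₂ (deriv u) = normLinf p₁ p₂ (derivWithin u (Set.Icc p₁ p₂)) :=
    normLinf_congr fun p hp => (derivWithin_of_mem_nhds (hnhds hp)).symm
  refine ⟨hc.comp (by fun_prop) hmap, hc'.comp (by fun_prop) hmap, fun x hx => ?_,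
    fun x hx => norm_le_normLinf h12 hc _ (hmap hx),
    fun x hx => (norm_le_normLinf h12 hc _ (hmap hx)).trans (le_max_left _ _),
    fun x hx => (norm_le_normLinf h12 hc' _ (hmap hx)).trans (heq ▸ le_max_right _ _)⟩
  have hx' : p₁ + x ∈ Set.Ioo p₁ p₂ := ⟨by linarith [hx.1], by linarith [hx.2]⟩
  have hd := (hu.differentiableOn one_ne_zero (p₁ + x) (Set.Ioo_subset_Icc_self hx')).hasDerivWithinAt
  exact (hd.hasDerivAt (hnhds hx')).comp_const_add p₁ x

theorem IsAmplitude.eq_amp (hU : IsAmplitude p₁ p₂ μ 1 1 U u) {p : ℝ}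
    (hp : p ∈ Set.Ioo p₁ p₂) : U p = (((p - p₁) ^ (μ - 1) : ℝ) : ℂ) * u p := by
  rw [hU.factor p hp]
  simp

theorem IsAmplitude.apply_right_eq_zero (hU : IsAmplitude p₁ p₂ μ 1 1 U u) (h12 : p₁ < p₂)
    (hUp₂ : Filter.Tendsto U (𝓝[<] p₂) (𝓝 0)) : u p₂ = 0 := by
  have hmem : Set.Ioo p₁ p₂ ∈ 𝓝[<] p₂ := Ioo_mem_nhdsLT h12
  have hle : 𝓝[<] p₂ ≤ 𝓝[Set.Icc p₁ p₂] p₂ := by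
    rw [← nhdsWithin_Ioo_eq_nhdsLT h12]
    exact nhdsWithin_mono _ Set.Ioo_subset_Icc_self
  have hu : Filter.Tendsto u (𝓝[<] p₂) (𝓝 (u p₂)) :=
    (hU.contDiffOn.continuousOn p₂ ⟨h12.le, le_rfl⟩).mono_left hle
  have hr : ContinuousAt (fun p : ℝ => (((p - p₁) ^ (μ - 1) : ℝ) : ℂ)) p₂ := by
    refine Complex.continuous_ofReal.continuousAt.comp ?_
    exact ContinuousAt.rpow_const (by fun_prop) (Or.inl (sub_pos.2 h12).ne')
  have h1 := (hr.tendsto.mono_left nhdsWithin_le_nhds).mul hu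
  have h2 : Filter.Tendsto U (𝓝[<] p₂) (𝓝 ((((p₂ - p₁) ^ (μ - 1) : ℝ) : ℂ) * u p₂)) := by
    refine h1.congr' ?_
    filter_upwards [hmem] with p hp using (hU.eq_amp hp).symm
  have h3 := tendsto_nhds_unique h2 hUp₂
  refine (mul_eq_zero.1 h3).resolve_left ?_
  exact_mod_cast (Real.rpow_pos_of_pos (sub_pos.2 h12) _).ne'

/-- The integrand in the variable `x = p - p₁`. -/
theorem IsAmplitude.integrand_eq (hU : IsAmplitude p₁ p₂ μ 1 1 U u) (ω : ℝ) {p : ℝ}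
    (hp : p ∈ Set.Ioo p₁ p₂) : integrand U (phase p₀ c) ω p =
      Complex.exp (Complex.I * ω * c) * (amp μ (fun x => u (p₁ + x)) (p - p₁) *
        Complex.exp (-(Complex.I * ω * ((p - p₁ - (p₀ - p₁)) ^ 2 : ℝ)))) := by
  have h : Complex.exp (Complex.I * ω * phase p₀ c p) = Complex.exp (Complex.I * ω * c) *
      Complex.exp (-(Complex.I * ω * ((p - p₁ - (p₀ - p₁)) ^ 2 : ℝ))) := by
    rw [← Complex.exp_add, phase]
    congr 1
    push_cast
    ring
  rw [integrand, hU.eq_amp hp, amp, h, add_sub_cancel]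
  ring

theorem IsAmplitude.ae_integrand_eq (hU : IsAmplitude p₁ p₂ μ 1 1 U u) (h12 : p₁ < p₂)
    (ω : ℝ) : ∀ᵐ p, p ∈ Set.uIoc p₁ p₂ → integrand U (phase p₀ c) ω p =
      Complex.exp (Complex.I * ω * c) * (amp μ (fun x => u (p₁ + x)) (p - p₁) *
        Complex.exp (-(Complex.I * ω * ((p - p₁ - (p₀ - p₁)) ^ 2 : ℝ)))) := by
  filter_upwards [compl_mem_ae_iff.2 (measure_singleton p₂)] with p hp hp'
  rw [Set.uIoc_of_le h12.le] at hp'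
  exact hU.integrand_eq ω ⟨hp'.1, lt_of_le_of_ne hp'.2 hp⟩

theorem IsAmplitude.intervalIntegrable_integrand (hU : IsAmplitude p₁ p₂ μ 1 1 U u)
    (h12 : p₁ < p₂) (hμ : 0 < μ) (ω : ℝ) :
    IntervalIntegrable (integrand U (phase p₀ c) ω) volume p₁ p₂ := by
  have hP : 0 ≤ p₂ - p₁ := by linarith
  have h := (((hU.boundedC1 h12).intervalIntegrable_amp_mul hP hμ
    (e := fun x => Complex.exp (-(Complex.I * ω * ((x - (p₀ - p₁)) ^ 2 : ℝ)))) (by fun_prop)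
    ⟨le_rfl, hP⟩ ⟨hP, le_rfl⟩).comp_sub_right p₁).const_mul (Complex.exp (Complex.I * ω * c))
  rw [zero_add, sub_add_cancel] at h
  refine h.congr_ae ((ae_restrict_iff' measurableSet_uIoc).2 ?_)
  filter_upwards [hU.ae_integrand_eq (p₀ := p₀) (c := c) h12 ω] with p hp hp'
  exact (hp hp').symm

/-- The value `jac` at 0 is (2A)^(-μ), the source of the 2^(-μ) in `coeffK`; twice `fresnelTail` at
0 restores the full √π of `coeffH`. -/
theorem exp_mul_boundary_eq {ω : ℝ} (hp₀ : p₁ < p₀) (hμ : 0 < μ) (hω : 0 < ω) :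
    Complex.exp (Complex.I * ω * c) *
      (-(2 * amp μ (fun x => u (p₁ + x)) (p₀ - p₁) * fresnelTail ω 0) -
        Complex.exp (-(Complex.I * ω * ((p₀ - p₁) ^ 2 : ℝ))) *
          ((jac (p₀ - p₁) μ 0 : ℂ) * u (p₁ + 0) * oscTail μ ω 0)) =
    coeffH p₀ c u ω * (((p₀ - p₁) ^ (μ - 1) * ω ^ (-(1 / 2 : ℝ)) : ℝ) : ℂ) +
      coeffK μ p₁ (phase p₀ c) u ω * (((p₀ - p₁) ^ (-μ) * ω ^ (-μ) : ℝ) : ℂ) := by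
  have hA : 0 < p₀ - p₁ := sub_pos.2 hp₀
  have hj : jac (p₀ - p₁) μ 0 = (p₀ - p₁) ^ (-μ) / 2 ^ μ := by
    rw [jac, sub_zero, sub_zero, Real.rpow_sub (by linarith), Real.rpow_one,
      Real.mul_rpow zero_le_two hA.le, Real.rpow_neg hA.le]
    have : (p₀ - p₁) ^ μ ≠ 0 := (Real.rpow_pos_of_pos hA μ).ne'
    field_simp
  have he : Complex.exp (Complex.I * ω * c) *
      Complex.exp (-(Complex.I * ω * ((p₀ - p₁) ^ 2 : ℝ))) =
      Complex.exp (Complex.I * ω * phase p₀ c p₁) := by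
    rw [← Complex.exp_add, phase]
    congr 1
    push_cast
    ring
  rw [mul_sub, ← mul_assoc _ (Complex.exp (-(Complex.I * ω * ((p₀ - p₁) ^ 2 : ℝ)))), he, hj,
    fresnelTail_zero hω, oscTail_zero hμ hω, amp, coeffH, coeffK, add_sub_cancel, add_zero]
  push_cast
  ring

/-- The expansion with both contributions: the stationary point `p₀` and the singularity `p₁`. -/
theorem IsAmplitude.norm_integral_sub_le (hU : IsAmplitude p₁ p₂ μ 1 1 U u)
    (hp₀ : p₀ ∈ Set.Ioo p₁ p₂) (hμ : μ ∈ Set.Ioo (0 : ℝ) 1)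
    (hUp₂ : Filter.Tendsto U (𝓝[<] p₂) (𝓝 0)) (hδ : δ ∈ Set.Ioo (1 / 2 : ℝ) 1) {ω : ℝ}
    (hω : 0 < ω) :
    ‖(∫ p in p₁..p₂, integrand U (phase p₀ c) ω p) -
      (coeffH p₀ c u ω * (((p₀ - p₁) ^ (μ - 1) * ω ^ (-(1 / 2 : ℝ)) : ℝ) : ℂ) +
        coeffK μ p₁ (phase p₀ c) u ω * (((p₀ - p₁) ^ (-μ) * ω ^ (-μ) : ℝ) : ℂ))‖ ≤
      ∑ k : Fin 8, REq p₁ p₂ μ δ u k * (p₀ - p₁) ^ (-αEq μ δ k) * ω ^ (-βEq δ k) := by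
  have h12 : p₁ < p₂ := hp₀.1.trans hp₀.2
  have hA : p₀ - p₁ ∈ Set.Ioo 0 (p₂ - p₁) := ⟨by linarith [hp₀.1], by linarith [hp₀.2]⟩
  rw [intervalIntegral.integral_congr_ae (hU.ae_integrand_eq h12 ω),
    intervalIntegral.integral_const_mul, intervalIntegral.integral_comp_sub_right
      (fun x => amp μ (fun x => u (p₁ + x)) x *
        Complex.exp (-(Complex.I * ω * ((x - (p₀ - p₁)) ^ 2 : ℝ)))) p₁, sub_self,
    ← exp_mul_boundary_eq hp₀.1 hμ.1 hω, ← mul_sub, norm_mul, norm_exp_I_mul, one_mul]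
  refine ((hU.boundedC1 h12).norm_integral_sub_le hA ?_ hμ hω hδ).trans
    (remainder_le_sum hA.1 hμ hω hδ (normLinf_nonneg _ _ _))
  rw [add_sub_cancel]
  exact hU.apply_right_eq_zero h12 hUp₂

theorem norm_coeffH_le (hU : IsAmplitude p₁ p₂ μ 1 1 U u) (hp₀ : p₀ ∈ Set.Ioo p₁ p₂) (ω : ℝ) :
    ‖coeffH p₀ c u ω‖ ≤ Real.sqrt Real.pi * normLinf p₁ p₂ u := by
  have h1 : ‖Complex.exp (-(Complex.I * (Real.pi / 4)))‖ = 1 := by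
    have := norm_exp_neg_I_mul (Real.pi / 4) 1
    simpa using this
  rw [coeffH, norm_mul, norm_mul, norm_mul, norm_exp_I_mul, h1, Complex.norm_real,
    Real.norm_of_nonneg (Real.sqrt_nonneg _), mul_one, mul_one]
  gcongr
  exact norm_le_normLinf (hp₀.1.trans hp₀.2) hU.contDiffOn.continuousOn p₀
    (Set.Ioo_subset_Icc_self hp₀)

theorem norm_coeffK_le (hU : IsAmplitude p₁ p₂ μ 1 1 U u) (h12 : p₁ < p₂) (hμ : 0 < μ)
    (ψ : ℝ → ℝ) (ω : ℝ) :
    ‖coeffK μ p₁ ψ u ω‖ ≤ Real.Gamma μ / (2 : ℝ) ^ μ * normLinf p₁ p₂ u := by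
  have h1 : ‖Complex.exp (Complex.I * (Real.pi * μ / 2))‖ = 1 := by
    have := norm_exp_I_mul (Real.pi * μ / 2) 1
    simpa using this
  have hΓ : 0 ≤ Real.Gamma μ / (2 : ℝ) ^ μ := by
    have := Real.Gamma_pos_of_pos hμ
    positivity
  rw [coeffK, norm_mul, norm_mul, norm_mul, norm_exp_I_mul, h1, Complex.norm_real,
    Real.norm_of_nonneg hΓ, mul_one, mul_one]
  gcongr
  exact norm_le_normLinf h12 hU.contDiffOn.continuousOn p₁ ⟨le_rfl, h12.le⟩

theorem REq_nonneg (h12 : p₁ < p₂) (hμ : μ ∈ Set.Ioo (0 : ℝ) 1)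
    (hδ : δ ∈ Set.Ioo (1 / 2 : ℝ) 1) (k : Fin 8) : 0 ≤ REq p₁ p₂ μ δ u k := by
  have hM := normLinf_nonneg p₁ p₂ u
  have hW : 0 ≤ normW1inf p₁ p₂ u := hM.trans (le_max_left _ _)
  have hL := constL_nonneg (2 * δ - 1)
  have h1 : 0 ≤ 1 - (2 * δ - 1) := by linarith [hδ.2]
  have h2 : 0 ≤ 1 - μ := by linarith [hμ.2]
  have h3 : 0 ≤ 2 - μ := by linarith
  have h4 : 0 < μ := hμ.1
  have h5 : 0 ≤ p₂ - p₁ := by linarith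
  rw [REq_eq]
  fin_cases k <;> simp only [Fin.reduceFinMk, Matrix.cons_val] <;> positivity

theorem half_lt_βEq (hδ : δ ∈ Set.Ioo (1 / 2 : ℝ) 1) (k : Fin 8) : 1 / 2 < βEq δ k := by
  rw [βEq_eq]
  fin_cases k <;> simp only [Fin.reduceFinMk, Matrix.cons_val] <;> linarith [hδ.1]

end

end StatPhase

end

/-! ### The three regimes -/

theorem corollary3p2 (p₁ p₂ p₀ c μ δ : ℝ) (U u : ℝ → ℂ)
    (hp₀ : p₀ ∈ Set.Ioo p₁ p₂) (hμ : μ ∈ Set.Ioo (0 : ℝ) 1)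
    (hU : StatPhase.IsAmplitude p₁ p₂ μ 1 1 U u)
    -- `U(p₂) = 0`, for the continuous extension of `U` to `(p₁, p₂]`
    (hUp₂ : Filter.Tendsto U (𝓝[<] p₂) (𝓝 0))
    -- the free parameter of the remainder
    (hδ : δ ∈ Set.Ioo (1 / 2 : ℝ) 1) :
    (∀ ω : ℝ, IntervalIntegrable
      (StatPhase.integrand U (StatPhase.phase p₀ c) ω) volume p₁ p₂) ∧
    (1 / 2 < μ →
      (∀ k, 0 ≤ StatPhase.RGt p₁ p₂ μ δ u k) ∧
      (∀ k, 1 / 2 < StatPhase.βGt μ δ k) ∧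
      ∀ ω : ℝ, 0 < ω →
        ‖(∫ p in p₁..p₂, StatPhase.integrand U (StatPhase.phase p₀ c) ω p) -
            StatPhase.coeffH p₀ c u ω *
              (((p₀ - p₁) ^ (μ - 1) * ω ^ (-(1 / 2 : ℝ)) : ℝ) : ℂ)‖ ≤
          ∑ k : Fin 9, StatPhase.RGt p₁ p₂ μ δ u k *
            (p₀ - p₁) ^ (-StatPhase.αGt μ δ k) * ω ^ (-StatPhase.βGt μ δ k)) ∧
    (μ = 1 / 2 →
      (∀ k, 0 ≤ StatPhase.REq p₁ p₂ μ δ u k) ∧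
      (∀ k, 1 / 2 < StatPhase.βEq δ k) ∧
      ∀ ω : ℝ, 0 < ω →
        ‖(∫ p in p₁..p₂, StatPhase.integrand U (StatPhase.phase p₀ c) ω p) -
            (StatPhase.coeffH p₀ c u ω +
                StatPhase.coeffK μ p₁ (StatPhase.phase p₀ c) u ω) *
              (((p₀ - p₁) ^ (-(1 / 2 : ℝ)) * ω ^ (-(1 / 2 : ℝ)) : ℝ) : ℂ)‖ ≤
          ∑ k : Fin 8, StatPhase.REq p₁ p₂ μ δ u k *
            (p₀ - p₁) ^ (-StatPhase.αEq μ δ k) * ω ^ (-StatPhase.βEq δ k)) ∧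
    (μ < 1 / 2 →
      (∀ k, 0 ≤ StatPhase.RLt p₁ p₂ μ δ u k) ∧
      (∀ k, μ < StatPhase.βLt δ k) ∧
      ∀ ω : ℝ, 0 < ω →
        ‖(∫ p in p₁..p₂, StatPhase.integrand U (StatPhase.phase p₀ c) ω p) -
            StatPhase.coeffK μ p₁ (StatPhase.phase p₀ c) u ω *
              (((p₀ - p₁) ^ (-μ) * ω ^ (-μ) : ℝ) : ℂ)‖ ≤
          ∑ k : Fin 9, StatPhase.RLt p₁ p₂ μ δ u k *
            (p₀ - p₁) ^ (-StatPhase.αLt μ δ k) * ω ^ (-StatPhase.βLt δ k)) := by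
  have h12 : p₁ < p₂ := hp₀.1.trans hp₀.2
  have hA : 0 < p₀ - p₁ := sub_pos.2 hp₀.1
  have hM := StatPhase.normLinf_nonneg p₁ p₂ u
  have hR := StatPhase.REq_nonneg (u := u) h12 hμ hδ
  have hβ := StatPhase.half_lt_βEq hδ
  have key {ω : ℝ} (hω : 0 < ω) := hU.norm_integral_sub_le (c := c) hp₀ hμ hUp₂ hδ hω
  refine ⟨hU.intervalIntegrable_integrand h12 hμ.1, fun hμ2 => ⟨?_, ?_, fun ω hω => ?_⟩,
    fun hμ2 => ⟨hR, hβ, fun ω hω => ?_⟩, fun hμ2 => ⟨?_, ?_, fun ω hω => ?_⟩⟩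
  · refine Fin.cases ?_ hR
    exact mul_nonneg (div_nonneg (Real.Gamma_pos_of_pos hμ.1).le (by positivity)) hM
  · exact Fin.cases hμ2 hβ
  · rw [Fin.sum_univ_succ]
    -- The singularity contributes ω^(-μ), of lower order than ω^(-1/2) here, and becomes the error
    -- of index 0.
    have hK : ‖StatPhase.coeffK μ p₁ (StatPhase.phase p₀ c) u ω *
        (((p₀ - p₁) ^ (-μ) * ω ^ (-μ) : ℝ) : ℂ)‖ ≤
        Real.Gamma μ / (2 : ℝ) ^ μ * StatPhase.normLinf p₁ p₂ u *
          (p₀ - p₁) ^ (-μ) * ω ^ (-μ) := by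
      rw [norm_mul, Complex.norm_real, Real.norm_of_nonneg (by positivity), mul_assoc _ _ (ω ^ _)]
      gcongr
      exact StatPhase.norm_coeffK_le hU h12 hμ.1 _ ω
    refine le_trans (le_of_eq ?_) ((norm_add_le _ _).trans (add_le_add hK (key hω)))
    congr 1
    ring
  -- Both exponents μ - 1 and -μ equal -1/2, so the two main terms merge with no additional error.
  · subst hμ2
    refine le_of_eq_of_le ?_ (key hω)
    rw [show (1 / 2 : ℝ) - 1 = -(1 / 2) by norm_num, ← add_mul]
  · refine Fin.cases ?_ hR
    exact mul_nonneg (Real.sqrt_nonneg _) hM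
  · exact Fin.cases hμ2 fun k => hμ2.trans (hβ k)
  · rw [Fin.sum_univ_succ]
    -- The roles are exchanged: the stationary point is now the lower-order contribution.
    have hH : ‖StatPhase.coeffH p₀ c u ω *
        (((p₀ - p₁) ^ (μ - 1) * ω ^ (-(1 / 2 : ℝ)) : ℝ) : ℂ)‖ ≤
        Real.sqrt Real.pi * StatPhase.normLinf p₁ p₂ u *
          (p₀ - p₁) ^ (-(1 - μ)) * ω ^ (-(1 / 2 : ℝ)) := by
      rw [norm_mul, Complex.norm_real, Real.norm_of_nonneg (by positivity), neg_sub,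
        mul_assoc _ _ (ω ^ _)]
      gcongr
      exact StatPhase.norm_coeffH_le hU hp₀ ω
    refine le_trans (le_of_eq ?_) ((norm_add_le _ _).trans (add_le_add hH (key hω)))
    congr 1
    ring
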